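/- Let $\mathcal{X}$ be a measurable space, let $\mathcal{Y}=\{-1,1\}$, and let $\mathcal{H}\subseteq\mathcal{Y}^{\mathcal{X}}$ be a class of measurable hypotheses. For a probability measure $\mathcal{D}$ on $\mathcal{X}\times\mathcal{Y}$ put $\mathcal{L}_{\mathcal{D}}(h)=\mathbb{P}_{(x,y)\sim\mathcal{D}}[h(x)\neq y]$. A learner $\mathcal{A}$, mapping finite sequences in $\mathcal{X}\times\mathcal{Y}$ to hypotheses, is an empirical risk minimization (ERM) learner for $\mathcal{H}$ if for every finite training sequence $S$ the hypothesis $\mathcal{A}(S)$ belongs to $\mathcal{H}$ and minimizes over $\mathcal{H}$ the fraction of the examples of $S$ that are misclassified. It is measurable if, for each $n$, the map $(S,x)\mapsto\mathcal{A}(S)(x)$ is measurable on $(\mathcal{X}\times\mathcal{Y})^n\times\mathcal{X}$. For finite sequences $S,T$ in $\mathcal{X}\times\mathcal{Y}$ with $|S|=3^k$, define a finite family $\mathcal{S}(S;T)$ of sequences (with repetitions) recursively; $\sqcup$ denotes concatenation. If $k<6$, then $\mathcal{S}(S;T)$ consists of the single sequence $S\sqcup T$. If $k\ge 6$, cut $S$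 into 27 consecutive blocks $S_1,\dots,S_{27}$ of length $3^{k-3}$; let $S_{i,\sqcup}$ be the first $3^{k-6}$ elements of $S_i$ and $S_{i,\sqcap}$ the remaining ones; then $\mathcal{S}(S;T)$ is the union, with repetitions, of the families $\mathcal{S}(S_{i,\sqcup};\,S_{i,\sqcap}\sqcup T)$ for $i=1,\dots,27$. Let $\mathcal{A}(S;T)=(\mathcal{A}(S'))_{S'\in\mathcal{S}(S;T)}$, and for $\alpha\in[0,1]$ let $\mathcal{L}^{\alpha}_{\mathcal{D}}(\mathcal{A}(S;T))$ be the probability over $(x,y)\sim\mathcal{D}$ that at least an $\alpha$-fraction of the hypotheses $h$ in the family $\mathcal{A}(S;T)$ satisfy $h(x)\neq y$. **Lemma.** There is a universal constant $c\ge 1$ such that the following holds. Let $\mathcal{H}$ be a class of measurable hypotheses of finite VC dimension $d$ on a measurable space $\mathcal{X}$, let $\mathcal{A}$ be a measurable ERM learner for $\mathcal{H}$, and let $\mathcal{D}$ be a probability measure on $\mathcal{X}\times\mathcal{Y}$ for which some $h^\star\in\mathcal{H}$ minimizes $\mathcal{L}_{\mathcal{D}}$ over $\mathcal{H}$; put $\tau=\mathcal{L}_{\mathcal{D}}(h^\star)$.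 Let $0<\delta<1$ and $m=3^k$ with $k\ge 6$. Then, with probability at least $1-\delta$ over a training sequence $\mathbf{S}\sim\mathcal{D}^m$, $$\mathcal{L}^{10/243}_{\mathcal{D}}\big(\mathcal{A}(\mathbf{S};\emptyset)\big)\;\le\; c\,\tau+\frac{c\,\big(d+\ln(e/\delta)\big)}{m}.$$ -/

import Mathlib

open MeasureTheory

namespace AgnosticERM

noncomputable section

/-- The label set `{-1, 1}`, as the group of units of `ℤ`. -/
abbrev Label : Type := ℤˣ

/-- Every subset of the label set is measurable. -/
instance : DiscreteMeasurableSpace Label where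
  forall_measurableSet s := by
    refine ⟨Units.val '' s, trivial, ?_⟩
    exact Set.preimage_image_eq s Units.val_injective

/-- Hypotheses (classifiers) on the domain `X`. -/
abbrev Hypothesis (X : Type*) : Type _ := X → Label

/-- Labeled examples. -/
abbrev Example (X : Type*) : Type _ := X × Label

/-- A learner maps finite training sequences to hypotheses. -/
abbrev Learner (X : Type*) : Type _ := List (Example X) → Hypothesis X

/-- `H` shatters the finite set `s`: every labeling of `s` is realized by a member of `H`. -/
def Shatters {X : Type*} (H : Set (Hypothesis X)) (s : Finset X) : Prop :=
  ∀ f : X → Label, ∃ h ∈ H, ∀ x ∈ s, h x = f x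

/-- The VC dimension: the supremum of the cardinalities of the shattered finite sets. -/
def vcDim {X : Type*} (H : Set (Hypothesis X)) : ℕ∞ :=
  ⨆ (s : Finset X) (_ : Shatters H s), (s.card : ℕ∞)

/-- The true error of `h`: the `D`-probability that `h x ≠ y`. -/
def trueError {X : Type*} [MeasurableSpace X] (D : Measure (Example X)) (h : Hypothesis X) : ℝ :=
  D.real {z | h z.1 ≠ z.2}

/-- The empirical error of `h`: the fraction of the examples of `S` on which `h` errs
(and `0` on the empty sequence). -/
def empiricalError {X : Type*} (S : List (Example X)) (h : Hypothesis X) : ℝ :=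
  (S.countP (fun z => decide (h z.1 ≠ z.2)) : ℝ) / (S.length : ℝ)

/-- `A` is an empirical risk minimization learner for `H`: on each training sequence it outputs a
member of `H` whose empirical error is minimal over `H`. -/
def IsERM {X : Type*} (H : Set (Hypothesis X)) (A : Learner X) : Prop :=
  ∀ S : List (Example X), A S ∈ H ∧ ∀ h ∈ H, empiricalError S (A S) ≤ empiricalError S h

/-- The learner `A` is measurable: for each length `n`, the predicted label `A(S)(x)` is a jointly
measurable function of the training sequence `S` of length `n` and of the point `x`. -/
def IsMeasurableLearner {X : Type*} [MeasurableSpace X] (A : Learner X) : Prop :=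
  ∀ n : ℕ, Measurable (fun p : (Fin n → Example X) × X => A (List.ofFn p.1) p.2)

/-- The `i`-th of the consecutive blocks of length `b` of `S` (counting from `i = 0`). -/
def block {Z : Type*} (S : List Z) (b i : ℕ) : List Z :=
  (S.drop (i * b)).take b

/-- The splitting algorithm, run on sequences `S, T` with `|S| = 3 ^ k`; the result is the family
of all training sequences that its recursive calls return.

If `k ≥ 6` (written `k + 6` in the pattern), `S` is cut into `27` consecutive blocks
`S₁, …, S₂₇` of length `3 ^ (k - 3)`. The first `3 ^ (k - 6)` elements of `Sᵢ` are the new active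
sequence, and the remaining ones are put in front of `T`. If `k < 6`, the only output is `S`
followed by `T`. -/
def splits {Z : Type*} : (k : ℕ) → (S T : List Z) → List (List Z)
  | k + 6, S, T =>
      (List.range 27).flatMap fun i =>
        splits k ((block S (3 ^ (k + 3)) i).take (3 ^ k))
          ((block S (3 ^ (k + 3)) i).drop (3 ^ k) ++ T)
  | _, S, T => [S ++ T]

/-- The family `𝒜(S; T)` (with repetitions) of the outputs of the learner `A` on all training
sequences that the splitting algorithm creates from `S` and `T`, where `|S| = 3 ^ k`. -/
def ermFamily {X : Type*} (A : Learner X) (k : ℕ) (S T : List (Example X)) :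
    List (Hypothesis X) :=
  (splits k S T).map A

/-- The fraction of the hypotheses in the family `F` that err on the example `z`. -/
def avgNe {X : Type*} (F : List (Hypothesis X)) (z : Example X) : ℝ :=
  (F.countP (fun h => decide (h z.1 ≠ z.2)) : ℝ) / (F.length : ℝ)

/-- The probability that at least an `α`-fraction of the hypotheses in `F` err on a new example
drawn from `D`. -/
def fractionError {X : Type*} [MeasurableSpace X] (D : Measure (Example X)) (α : ℝ)
    (F : List (Hypothesis X)) : ℝ :=
  D.real {z | α ≤ avgNe F z}

end

end AgnosticERM

open AgnosticERM

/-!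
If at least a `10 / 243`-fraction of the whole family `𝒜(S; T)` errs on an example, then so does at
least a `10 / 243`-fraction of one of its 27 block families. As `27 · 10 / 243 - 1 = 1 / 9`, the
fractions that err in the other 26 block families add up to at least `1 / 9`, so the error of
`𝒜(S; T)` is at most `9` times the sum of the joint errors of the ordered pairs of distinct block
families.

For such a pair `(i, j)`, the region `R` on which the family `i` errs does not depend on the
reserved block of `j`, while every hypothesis of the family `j` is an ERM on a sequence that
contains this block. Given the other examples, a relative deviation bound on the `26 · 3 ^ k`
reserved examples, proved by symmetrization, therefore shows for every `x ∈ (0, 1]` that the joint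
error is of order `x · P(R) + (n + d ln(1 / x) + ln(1 / δ)) / 3 ^ k`, where `n` is the number of
errors of the comparison hypothesis. The parameter `x` enters through the Sauer-Shelah lemma: a
family of VC dimension `d` has at most `(1 + x) ^ N / x ^ d` traces on a sample with `N` points in
`R`.

By induction `P(R)` is of order `(n + d + ln(1 / δ)) / 3 ^ k`. The factor `x = 1 / 10 ^ 10` makes up
for the loss of `3 ^ 6` in the length, the number of pairs and the factor `9`, so the constant
`10 ^ 9` is reproduced from `k` to `k + 6`. A Chernoff bound finally replaces `n` by its mean.
-/

namespace AgnosticERM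

open Finset
open scoped BigOperators

section VCDim

variable {Z β : Type*}

/-- The family `𝒞` has VC dimension at most `d`: a finite set all of whose subsets are cut out by
members of `𝒞` has at most `d` elements. Used in place of `vcDim` because the sets of examples
misclassified by hypotheses do not form a class of `Label`-valued functions. -/
def VCDimLE (𝒞 : Set (Set Z)) (d : ℕ) : Prop :=
  ∀ s : Finset Z, (∀ t ⊆ s, ∃ E ∈ 𝒞, ∀ z ∈ s, z ∈ E ↔ z ∈ t) → #s ≤ d

theorem VCDimLE.image_inter {𝒞 : Set (Set Z)} {d : ℕ} (h𝒞 : VCDimLE 𝒞 d) (R : Set Z) :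
    VCDimLE ((· ∩ R) '' 𝒞) d := by
  refine fun s hs => h𝒞 s fun t ht => ?_
  have hsR : ∀ z ∈ s, z ∈ R := by
    obtain ⟨_, ⟨E, -, rfl⟩, hE⟩ := hs s Subset.rfl
    exact fun z hz => ((hE z hz).2 hz).2
  obtain ⟨_, ⟨E, hE𝒞, rfl⟩, hE⟩ := hs t ht
  exact ⟨E, hE𝒞, fun z hz => (and_iff_left (hsR z hz)).symm.trans (hE z hz)⟩

theorem card_mul_pow_vcDim_le [DecidableEq β] {𝒜 : Finset (Finset β)} {N : Finset β}
    (h𝒜 : ∀ P ∈ 𝒜, P ⊆ N) {d : ℕ} (hd : 𝒜.vcDim ≤ d) {x : ℝ} (hx0 : 0 ≤ x) (hx1 : x ≤ 1) :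
    #𝒜 * x ^ d ≤ (1 + x) ^ #N := by
  have hsub : 𝒜.shatterer ⊆ N.powerset := fun s hs => by
    obtain ⟨P, hP, hsP⟩ := (mem_shatterer.1 hs).exists_superset
    exact mem_powerset.2 (hsP.trans (h𝒜 P hP))
  calc (#𝒜 : ℝ) * x ^ d ≤ #𝒜.shatterer * x ^ d :=
        mul_le_mul_of_nonneg_right (mod_cast 𝒜.card_le_card_shatterer) (by positivity)
    _ = ∑ _s ∈ 𝒜.shatterer, x ^ d := by rw [sum_const, nsmul_eq_mul]
    _ ≤ ∑ s ∈ 𝒜.shatterer, x ^ #s := sum_le_sum fun s hs =>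
        pow_le_pow_of_le_one hx0 hx1 ((mem_shatterer.1 hs).card_le_vcDim.trans hd)
    _ ≤ ∑ s ∈ N.powerset, x ^ #s := sum_le_sum_of_subset_of_nonneg hsub fun _ _ _ => by positivity
    _ = (1 + x) ^ #N := by
        simpa only [one_pow, mul_one, add_comm] using sum_pow_mul_eq_add_pow x 1 N

variable [Fintype β]

open Classical in
/-- The trace of `E` on the sample `w`: the indices of the sample points that lie in `E`. -/
noncomputable def trace (E : Set Z) (w : β → Z) : Finset β :=
  {b | w b ∈ E}

/-- The number of points of the sample `w` that lie in `E`: the unnormalized empirical measure. -/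
noncomputable def hits (E : Set Z) (w : β → Z) : ℕ :=
  #(trace E w)

open Classical in
/-- The traces of the members of `𝒞` on the sample `w`; the growth function counts them. -/
noncomputable def traces (𝒞 : Set (Set Z)) (w : β → Z) : Finset (Finset β) :=
  {P | ∃ E ∈ 𝒞, trace E w = P}

@[simp]
theorem mem_trace {E : Set Z} {w : β → Z} {b : β} : b ∈ trace E w ↔ w b ∈ E := by
  simp [trace]

theorem mem_traces {𝒞 : Set (Set Z)} {w : β → Z} {P : Finset β} :
    P ∈ traces 𝒞 w ↔ ∃ E ∈ 𝒞, trace E w = P := by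
  simp [traces]

theorem VCDimLE.vcDim_traces_le [DecidableEq β] {𝒞 : Set (Set Z)} {d : ℕ} (h𝒞 : VCDimLE 𝒞 d)
    (w : β → Z) : (traces 𝒞 w).vcDim ≤ d := by
  classical
  refine Finset.sup_le fun s hs => ?_
  have hcut : ∀ t ⊆ s, ∃ E ∈ 𝒞, ∀ b ∈ s, w b ∈ E ↔ b ∈ t := fun t ht => by
    obtain ⟨_, hP, rfl⟩ := mem_shatterer.1 hs ht
    obtain ⟨E, hE, rfl⟩ := mem_traces.1 hP
    exact ⟨E, hE, fun b hb => by simp [hb]⟩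
  have hinj : Set.InjOn w s := fun a ha b hb hab => by
    obtain ⟨E, -, hE⟩ := hcut {a} (singleton_subset_iff.2 ha)
    have hbE : w b ∈ E := hab ▸ (hE a ha).2 (mem_singleton_self a)
    exact (mem_singleton.1 ((hE b hb).1 hbE)).symm
  rw [← card_image_of_injOn hinj]
  refine h𝒞 _ fun t _ => ?_
  obtain ⟨E, hE𝒞, hE⟩ := hcut {b ∈ s | w b ∈ t} (filter_subset _ _)
  refine ⟨E, hE𝒞, forall_mem_image.2 fun b hb => (hE b hb).trans ?_⟩
  simp [hb]

theorem VCDimLE.card_traces_mul_pow_le {𝒞 : Set (Set Z)} {d : ℕ} (h𝒞 : VCDimLE 𝒞 d) {R : Set Z}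
    (hR : ∀ E ∈ 𝒞, E ⊆ R) (w : β → Z) {x : ℝ} (hx0 : 0 ≤ x) (hx1 : x ≤ 1) :
    #(traces 𝒞 w) * x ^ d ≤ (1 + x) ^ hits R w := by
  classical
  refine card_mul_pow_vcDim_le (fun P hP b hb => ?_) (h𝒞.vcDim_traces_le w) hx0 hx1
  obtain ⟨E, hE, rfl⟩ := mem_traces.1 hP
  exact mem_trace.2 (hR E hE (mem_trace.1 hb))

end VCDim

section ErrorSets

variable {X : Type*}

/-- The set of examples that `h` misclassifies. -/
def errorSet (h : Hypothesis X) : Set (Example X) :=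
  {z | h z.1 ≠ z.2}

theorem label_eq_of_ne_of_ne {a b c : Label} (hac : a ≠ c) (hbc : b ≠ c) : a = b := by
  rw [Int.units_ne_iff_eq_neg.1 hac, Int.units_ne_iff_eq_neg.1 hbc]

theorem vcDimLE_errorSet {H : Set (Hypothesis X)} {d : ℕ} (hd : vcDim H ≤ d) :
    VCDimLE (errorSet '' H) d := by
  classical
  intro s hs
  have hcut : ∀ t ⊆ s, ∃ h ∈ H, ∀ z ∈ s, h z.1 ≠ z.2 ↔ z ∈ t := fun t ht => by
    obtain ⟨_, ⟨h, hH, rfl⟩, hh⟩ := hs t ht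
    exact ⟨h, hH, hh⟩
  -- Two examples `(x, 1)` and `(x, -1)` are never classified correctly by the same hypothesis.
  have hinj : Set.InjOn Prod.fst (s : Set (Example X)) := fun a ha b hb hab => by
    obtain ⟨h, -, hh⟩ := hcut ∅ (empty_subset s)
    have hcorrect : ∀ z ∈ s, h z.1 = z.2 := fun z hz => by simpa using hh z hz
    exact Prod.ext hab (by rw [← hcorrect a ha, ← hcorrect b hb, hab])
  have hshatters : Shatters H (s.image Prod.fst) := fun f => by
    obtain ⟨h, hH, hh⟩ := hcut {z ∈ s | f z.1 ≠ z.2} (filter_subset _ _)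
    refine ⟨h, hH, forall_mem_image.2 fun z hz => ?_⟩
    have hz' : h z.1 ≠ z.2 ↔ f z.1 ≠ z.2 := (hh z hz).trans (by simp [hz])
    by_cases hf : f z.1 = z.2
    · rw [hf, not_not.1 (mt hz'.1 (not_not.2 hf))]
    · exact label_eq_of_ne_of_ne (hz'.2 hf) hf
  have hcard : (#(s.image Prod.fst) : ℕ∞) ≤ vcDim H :=
    le_iSup₂ (f := fun (s : Finset X) (_ : Shatters H s) => (#s : ℕ∞)) _ hshatters
  rw [← card_image_of_injOn hinj]
  exact_mod_cast hcard.trans hd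

end ErrorSets

section Symmetrization

variable {Z κ ι β γ : Type*} [Fintype κ] [Fintype β] [Fintype γ]

theorem pow_hits (r : ℝ) (E : Set Z) [DecidablePred (· ∈ E)] (w : β → Z) :
    r ^ hits E w = ∏ b, if w b ∈ E then r else 1 := by
  rw [prod_ite, prod_const_one, mul_one, prod_const, hits, trace]
  congr!

theorem hits_le_card (E : Set Z) (w : β → Z) : hits E w ≤ Fintype.card β :=
  card_le_univ _

theorem hits_mono {E F : Set Z} (hEF : E ⊆ F) (w : β → Z) : hits E w ≤ hits F w :=
  card_le_card fun _ hb => mem_trace.2 (hEF (mem_trace.1 hb))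

theorem hits_comp_le_of_injective (E : Set Z) (w : β → Z) {f : γ → β} (hf : f.Injective) :
    hits E (fun c => w (f c)) ≤ hits E w :=
  card_le_card_of_injOn f (fun c hc => by simpa using hc) hf.injOn

theorem cast_hits (E : Set Z) (w : β → Z) : (hits E w : ℝ) = ∑ b, E.indicator 1 (w b) := by
  classical
  simp only [hits, trace, Set.indicator_apply, Pi.one_apply, sum_boole]

theorem hits_comp (E : Set Z) (w : β → Z) (f : γ → β) :
    hits E (fun c => w (f c)) = hits (trace E w : Set β) f :=
  congrArg card (by ext; simp)

theorem hits_swap_add_hits_swap (E : Set Z) (w : κ × Bool → Z) (σ : κ → Bool) :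
    hits E (fun a => w (a, σ a)) + hits E (fun a => w (a, !σ a)) = hits E w := by
  classical
  simp only [hits, trace, card_filter, Fintype.sum_prod_type, Fintype.sum_bool,
    ← sum_add_distrib]
  refine sum_congr rfl fun a _ => ?_
  cases σ a
  · exact add_comm _ _
  · rfl

theorem measurable_hits_comp {α : Type*} [MeasurableSpace α] {E : α → Set Z} {w : α → β → Z}
    (h : ∀ b, MeasurableSet {a | w a b ∈ E a}) : Measurable fun a => hits (E a) (w a) := by
  classical
  simp only [hits, trace, card_filter]
  exact Finset.measurable_sum _ fun b _ => Measurable.ite (h b) measurable_const measurable_const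

theorem expect_swap_le_one [DecidableEq κ] (P : Set (κ × Bool)) :
    𝔼 σ : κ → Bool, (1 / 2 : ℝ) ^ hits P (fun a => (a, σ a)) *
      (3 / 2) ^ hits P (fun a => (a, !σ a)) ≤ 1 := by
  classical
  let g (a : κ) (s : Bool) : ℝ :=
    (if (a, s) ∈ P then 1 / 2 else 1) * (if (a, !s) ∈ P then 3 / 2 else 1)
  -- As two, one or none of the pair `(a, ·)` lie in `P`, the mean over `s` of `g a s` is `3 / 4`,
  -- `(1 / 2 + 3 / 2) / 2 = 1` or `1`.
  have hg : ∀ a, 0 ≤ ∑ s, g a s ∧ ∑ s, g a s ≤ 2 := fun a => by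
    simp only [g, Fintype.sum_bool, Bool.not_true, Bool.not_false]
    constructor <;> split_ifs <;> norm_num
  simp_rw [pow_hits, ← prod_mul_distrib]
  rw [Fintype.expect_eq_sum_div_card, div_le_one (by positivity)]
  calc ∑ σ : κ → Bool, ∏ a, g a (σ a) = ∏ a, ∑ s, g a s := (Fintype.prod_sum g).symm
    _ ≤ ∏ _a : κ, 2 := prod_le_prod (fun a _ => (hg a).1) fun a _ => (hg a).2
    _ = Fintype.card (κ → Bool) := by simp

/-- The mean over `i` of the exponential weight that compares the sample `S`, on which the set
`E i S` depends, with an independent ghost sample `G`: hits of `E i S` in `S` lower it, hits of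
`E i S` in `G` raise it, and the factors `(1 + x)⁻¹` on the hits of `R` pay for the number of
traces, as `VCDimLE.card_traces_mul_pow_le` requires. -/
noncomputable def ghostMoment [Fintype ι] (x : ℝ) (R : Set Z) (E : ι → (κ → Z) → Set Z)
    (S G : κ → Z) : ℝ :=
  𝔼 i, (1 / 2) ^ hits (E i S) S * (1 + x)⁻¹ ^ hits R S *
    ((3 / 2) ^ hits (E i S) G * (1 + x)⁻¹ ^ hits R G)

variable [Fintype ι]

theorem ghostMoment_nonneg {x : ℝ} (hx : 0 ≤ x) (R : Set Z) (E : ι → (κ → Z) → Set Z)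
    (S G : κ → Z) : 0 ≤ ghostMoment x R E S G :=
  expect_nonneg fun _ _ => by positivity

theorem expect_ghostMoment_swap_le [Nonempty ι] [DecidableEq κ] {𝒞 : Set (Set Z)} {d : ℕ}
    (h𝒞 : VCDimLE 𝒞 d) {R : Set Z} (hR : ∀ E ∈ 𝒞, E ⊆ R)
    {E : ι → (κ → Z) → Set Z} (hE : ∀ i S, E i S ∈ 𝒞)
    {x : ℝ} (hx0 : 0 < x) (hx1 : x ≤ 1) (w : κ × Bool → Z) :
    𝔼 σ : κ → Bool, ghostMoment x R E (fun a => w (a, σ a)) (fun a => w (a, !σ a)) ≤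
      (x ^ d)⁻¹ := by
  classical
  let g (P : Finset (κ × Bool)) (σ : κ → Bool) : ℝ :=
    (1 / 2) ^ hits (P : Set (κ × Bool)) (fun a => (a, σ a)) *
      (3 / 2) ^ hits (P : Set (κ × Bool)) (fun a => (a, !σ a))
  have hmoment (σ : κ → Bool) :
      ghostMoment x R E (fun a => w (a, σ a)) (fun a => w (a, !σ a)) ≤
        (∑ P ∈ traces 𝒞 w, g P σ) * (1 + x)⁻¹ ^ hits R w := by
    refine expect_le univ_nonempty fun i _ => ?_
    set E' := E i fun a => w (a, σ a)
    rw [mul_mul_mul_comm, ← pow_add, hits_swap_add_hits_swap, hits_comp E', hits_comp E']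
    gcongr
    exact single_le_sum (f := fun P => g P σ) (fun P _ => by positivity)
      (mem_traces.2 ⟨_, hE i _, rfl⟩)
  have hcard := h𝒞.card_traces_mul_pow_le hR w hx0.le hx1
  calc _ ≤ 𝔼 σ : κ → Bool, (∑ P ∈ traces 𝒞 w, g P σ) * (1 + x)⁻¹ ^ hits R w :=
        expect_le_expect fun σ _ => hmoment σ
    _ = (∑ P ∈ traces 𝒞 w, 𝔼 σ : κ → Bool, g P σ) * (1 + x)⁻¹ ^ hits R w := by
        rw [← expect_mul, expect_sum_comm]
    _ ≤ (∑ P ∈ traces 𝒞 w, 1) * (1 + x)⁻¹ ^ hits R w := by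
        gcongr with P
        exact expect_swap_le_one _
    _ ≤ (x ^ d)⁻¹ := by
        rw [sum_const, nsmul_one, inv_pow, ← div_eq_mul_inv, div_le_iff₀ (by positivity),
          ← div_eq_inv_mul, le_div_iff₀ (by positivity)]
        exact hcard

theorem measurable_ghostMoment [MeasurableSpace Z] {x : ℝ} {R : Set Z} (hR : MeasurableSet R)
    {E : ι → (κ → Z) → Set Z} (hE : ∀ i, MeasurableSet {p : (κ → Z) × Z | p.2 ∈ E i p.1}) :
    Measurable fun p : (κ → Z) × (κ → Z) => ghostMoment x R E p.1 p.2 := by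
  simp only [ghostMoment, Fintype.expect_eq_sum_div_card]
  have hpow (r : ℝ) {f : (κ → Z) × (κ → Z) → ℕ} (hf : Measurable f) : Measurable fun p => r ^ f p :=
    (measurable_from_nat (f := (r ^ ·))).comp hf
  have hSa (a : κ) : Measurable fun p : (κ → Z) × (κ → Z) => (p.1, p.1 a) := by fun_prop
  have hGa (a : κ) : Measurable fun p : (κ → Z) × (κ → Z) => (p.1, p.2 a) := by fun_prop
  refine (Finset.measurable_sum _ fun i _ => ?_).div_const _
  exact ((hpow _ (measurable_hits_comp fun a => hSa a (hE i))).mul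
    (hpow _ (measurable_hits_comp fun a => (hSa a).snd hR))).mul
    ((hpow _ (measurable_hits_comp fun a => hGa a (hE i))).mul
    (hpow _ (measurable_hits_comp fun a => (hGa a).snd hR)))

end Symmetrization

section RelativeDeviation

theorem integral_expect {α ι : Type*} [Fintype ι] [MeasurableSpace α] {μ : Measure α}
    {f : ι → α → ℝ} (hf : ∀ i, Integrable (f i) μ) :
    ∫ a, 𝔼 i, f i a ∂μ = 𝔼 i, ∫ a, f i a ∂μ := by
  simp only [Fintype.expect_eq_sum_div_card, integral_div]
  rw [integral_finsetSum _ fun i _ => hf i]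

theorem measureReal_div_le_le {α : Type*} [MeasurableSpace α] {μ : Measure α}
    {f : α → ℝ} (hf : Integrable f μ) (h0 : ∀ a, 0 ≤ f a) {M δ : ℝ}
    (hM : 0 < M) (hδ : 0 < δ) (h : ∫ a, f a ∂μ ≤ M) : μ.real {a | M / δ ≤ f a} ≤ δ := by
  have hmarkov := mul_meas_ge_le_integral_of_nonneg (.of_forall h0) hf (M / δ)
  rw [div_mul_eq_mul_div, div_le_iff₀ hδ] at hmarkov
  exact le_of_mul_le_mul_left (hmarkov.trans (by gcongr)) hM

variable {Z κ ι : Type*} [Fintype κ] [Fintype ι]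

theorem pow_hits_mul_pow_hits {E R : Set Z} (hER : E ⊆ R) (a b : ℝ) (G : κ → Z) :
    a ^ hits E G * b ^ hits R G =
      ∏ c, (1 + R.indicator (fun _ => b - 1) (G c) + E.indicator (fun _ => b * (a - 1)) (G c)) := by
  classical
  simp_rw [pow_hits, ← prod_mul_distrib]
  refine prod_congr rfl fun c _ => ?_
  by_cases hE : G c ∈ E
  · simp only [hE, hER hE, if_true, Set.indicator_of_mem]
    ring
  · by_cases hR : G c ∈ R <;> simp [hE, hR]

variable [MeasurableSpace Z]

theorem measurePreserving_swap (D : Measure Z) [SigmaFinite D] (σ : κ → Bool) :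
    MeasurePreserving (fun w : κ × Bool → Z => (fun a => w (a, σ a), fun a => w (a, !σ a)))
      (Measure.pi fun _ => D) ((Measure.pi fun _ => D).prod (Measure.pi fun _ => D)) := by
  let f : κ ⊕ κ → κ × Bool := Sum.elim (fun a => (a, σ a)) (fun a => (a, !σ a))
  have hf : f.Bijective := by
    refine ⟨?_, fun ⟨a, s⟩ => ?_⟩
    · rintro (a | a) (b | b) hab <;> simp only [f, Sum.elim_inl, Sum.elim_inr, Prod.ext_iff] at hab
        <;> obtain ⟨rfl, hσ⟩ := hab <;> simp_all
    · obtain hs | hs := Bool.eq_or_eq_not s (σ a)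
      · exact ⟨.inl a, by simp [f, hs]⟩
      · exact ⟨.inr a, by simp [f, hs]⟩
  exact (measurePreserving_sumPiEquivProdPi fun _ : κ ⊕ κ => D).comp
    (measurePreserving_piCongrLeft (fun _ => D) (Equiv.ofBijective f hf)).symm

theorem integrable_pow_hits_mul_pow_hits (D : Measure Z) [IsFiniteMeasure D] {E R : Set Z}
    (hE : MeasurableSet E) (hR : MeasurableSet R) (hER : E ⊆ R) (a b : ℝ) :
    Integrable (fun G : κ → Z => a ^ hits E G * b ^ hits R G) (Measure.pi fun _ => D) := by
  simp_rw [pow_hits_mul_pow_hits hER]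
  exact Integrable.fintype_prod (f := fun _ z =>
    1 + R.indicator (fun _ => b - 1) z + E.indicator (fun _ => b * (a - 1)) z) fun _ =>
    ((integrable_const 1).add ((integrable_const _).indicator hR)).add
      ((integrable_const _).indicator hE)

theorem integral_pow_hits_mul_pow_hits (D : Measure Z) [IsProbabilityMeasure D] {E R : Set Z}
    (hE : MeasurableSet E) (hR : MeasurableSet R) (hER : E ⊆ R) (a b : ℝ) :
    ∫ G : κ → Z, a ^ hits E G * b ^ hits R G ∂(Measure.pi fun _ => D) =
      (1 + (b - 1) * D.real R + b * (a - 1) * D.real E) ^ Fintype.card κ := by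
  have hindicator {A : Set Z} (hA : MeasurableSet A) (c : ℝ) :
      Integrable (A.indicator fun _ => c) D := (integrable_const c).indicator hA
  simp_rw [pow_hits_mul_pow_hits hER]
  rw [integral_fintype_prod_eq_pow (𝕜 := ℝ) fun z =>
      1 + R.indicator (fun _ => b - 1) z + E.indicator (fun _ => b * (a - 1)) z,
    integral_add (f := fun z => 1 + R.indicator (fun _ => b - 1) z)
      ((integrable_const 1).add (hindicator hR _)) (hindicator hE _),
    integral_add (integrable_const 1) (hindicator hR _), integral_indicator_const _ hR,
    integral_indicator_const _ hE, integral_const, probReal_univ]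
  simp only [smul_eq_mul]
  ring

theorem measureReal_lt_hits_le (D : Measure Z) [IsProbabilityMeasure D] {R : Set Z}
    (hR : MeasurableSet R) {δ : ℝ} (hδ : 0 < δ) :
    (Measure.pi fun _ : κ => D).real
      {S | 2 * Fintype.card κ * D.real R + Real.log (1 / δ) < hits R S} ≤ δ := by
  set n := Fintype.card κ
  have hmgf : ∫ S : κ → Z, Real.exp (hits R S) ∂(Measure.pi fun _ => D) ≤
      Real.exp (2 * n * D.real R) := by
    have hmoment := integral_pow_hits_mul_pow_hits (κ := κ) D hR hR subset_rfl (Real.exp 1) 1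
    simp only [one_pow, mul_one, sub_self, zero_mul, add_zero, one_mul, ← Real.exp_nat_mul]
      at hmoment
    rw [hmoment, mul_right_comm, mul_comm _ (n : ℝ), Real.exp_nat_mul]
    have he := Real.add_one_le_exp 1
    have he' := Real.exp_one_lt_d9
    have hexp := Real.add_one_le_exp (2 * D.real R)
    have hpos : 0 ≤ D.real R := measureReal_nonneg
    exact pow_le_pow_left₀ (by nlinarith) (by nlinarith) n
  have hint : Integrable (fun S : κ → Z => Real.exp (hits R S)) (Measure.pi fun _ => D) := by
    simpa [← Real.exp_nat_mul] using
      integrable_pow_hits_mul_pow_hits (κ := κ) D hR hR subset_rfl (Real.exp 1) 1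
  refine (measureReal_mono fun S hS => ?_).trans (measureReal_div_le_le hint
    (fun _ => Real.exp_nonneg _) (Real.exp_pos _) hδ hmgf)
  have hS' := Real.exp_le_exp.2 (Set.mem_ofPred.1 hS).le
  rwa [Real.exp_add, Real.exp_log (by positivity), mul_one_div] at hS'

theorem pow_expect_le_expect_pow [Nonempty ι] {f : ι → ℝ} (hf : ∀ i, 0 ≤ f i) (n : ℕ) :
    (𝔼 i, f i) ^ n ≤ 𝔼 i, f i ^ n := by
  have hcard : (Fintype.card ι : ℝ) ≠ 0 := Nat.cast_ne_zero.2 Fintype.card_ne_zero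
  simpa only [Fintype.expect_eq_sum_div_card, div_eq_inv_mul, mul_sum] using
    Real.pow_arith_mean_le_arith_mean_pow univ (fun _ : ι => (Fintype.card ι : ℝ)⁻¹) f
      (fun _ _ => by positivity) (by simp [hcard]) (fun i _ => hf i) n

theorem exp_half_le_one_add {u : ℝ} (h0 : 0 ≤ u) (h1 : u ≤ 1) : Real.exp (u / 2) ≤ 1 + u :=
  calc Real.exp (u / 2) ≤ (1 - u / 2)⁻¹ := by
        rw [← inv_inv (Real.exp _), ← Real.exp_neg]
        exact inv_anti₀ (by linarith) (Real.one_sub_le_exp_neg _)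
    _ ≤ 1 + u := by
        rw [inv_le_iff_one_le_mul₀ (by linarith)]
        nlinarith

theorem exp_neg_le_half_pow_mul_inv_pow {x b : ℝ} (hx : 0 ≤ x) {m n : ℕ} (hm : m ≤ b) :
    Real.exp (-b - x * n) ≤ (1 / 2) ^ m * (1 + x)⁻¹ ^ n := by
  have hhalf : Real.exp (-1) ≤ 1 / 2 := by linarith [Real.exp_neg_one_lt_d9]
  have hinv : Real.exp (-x) ≤ (1 + x)⁻¹ := by
    rw [Real.exp_neg, add_comm]
    exact inv_anti₀ (by positivity) (Real.add_one_le_exp x)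
  calc Real.exp (-b - x * n) ≤ Real.exp (m * (-1) + n * (-x)) := Real.exp_le_exp.2 (by linarith)
    _ = Real.exp (-1) ^ m * Real.exp (-x) ^ n := by
        rw [Real.exp_add, Real.exp_nat_mul, Real.exp_nat_mul]
    _ ≤ (1 / 2) ^ m * (1 + x)⁻¹ ^ n := by gcongr

section Moment

variable {D : Measure Z} [IsProbabilityMeasure D] {R : Set Z} {E : ι → (κ → Z) → Set Z} {x : ℝ}

theorem integrable_ghostMoment [Nonempty ι] (hR : MeasurableSet R)
    (hE : ∀ i, MeasurableSet {p : (κ → Z) × Z | p.2 ∈ E i p.1}) (hx : 0 ≤ x)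
    (μ : Measure ((κ → Z) × (κ → Z))) [IsFiniteMeasure μ] :
    Integrable (fun p : (κ → Z) × (κ → Z) => ghostMoment x R E p.1 p.2) μ := by
  refine .of_bound (measurable_ghostMoment hR hE).aestronglyMeasurable
    ((3 / 2) ^ Fintype.card κ) (.of_forall fun p => ?_)
  rw [Real.norm_of_nonneg (ghostMoment_nonneg hx _ _ _ _)]
  refine expect_le univ_nonempty fun i _ => ?_
  have hinv : (1 + x)⁻¹ ≤ 1 := inv_le_one_of_one_le₀ (by linarith)
  calc _ ≤ (1 : ℝ) * 1 * ((3 / 2) ^ Fintype.card κ * 1) := by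
        gcongr
        · exact pow_le_one₀ (by norm_num) (by norm_num)
        · exact pow_le_one₀ (by positivity) hinv
        · norm_num
        · exact hits_le_card _ _
        · exact pow_le_one₀ (by positivity) hinv
    _ = _ := by ring

theorem integral_ghostMoment_le [Nonempty ι] {𝒞 : Set (Set Z)} {d : ℕ} (h𝒞 : VCDimLE 𝒞 d)
    (h𝒞R : ∀ E ∈ 𝒞, E ⊆ R) (hR : MeasurableSet R) (hE𝒞 : ∀ i S, E i S ∈ 𝒞)
    (hE : ∀ i, MeasurableSet {p : (κ → Z) × Z | p.2 ∈ E i p.1}) (hx0 : 0 < x) (hx1 : x ≤ 1) :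
    ∫ p, ghostMoment x R E p.1 p.2 ∂((Measure.pi fun _ : κ => D).prod (Measure.pi fun _ => D)) ≤
      (x ^ d)⁻¹ := by
  classical
  have hswap := measurePreserving_swap (κ := κ) D
  have hint := integrable_ghostMoment hR hE hx0.le
    ((Measure.pi fun _ : κ => D).prod (Measure.pi fun _ => D))
  have hintσ (σ : κ → Bool) := (hswap σ).integrable_comp_of_integrable hint
  calc _ = 𝔼 σ : κ → Bool, ∫ w, ghostMoment x R E (fun a => w (a, σ a)) (fun a => w (a, !σ a))
          ∂(Measure.pi fun _ => D) := by
        refine (Fintype.expect_const _).symm.trans (expect_congr rfl fun σ _ => ?_)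
        rw [← (hswap σ).map_eq]
        exact integral_map (hswap σ).measurable.aemeasurable
          (measurable_ghostMoment hR hE).aestronglyMeasurable
    _ = ∫ w, 𝔼 σ : κ → Bool, ghostMoment x R E (fun a => w (a, σ a)) (fun a => w (a, !σ a))
          ∂(Measure.pi fun _ => D) := (integral_expect hintσ).symm
    _ ≤ ∫ _w : κ × Bool → Z, (x ^ d)⁻¹ ∂(Measure.pi fun _ => D) := by
        refine integral_mono_of_nonneg (.of_forall fun w => expect_nonneg fun σ _ =>
          ghostMoment_nonneg hx0.le _ _ _ _) (integrable_const _) (.of_forall fun w => ?_)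
        exact expect_ghostMoment_swap_le h𝒞 h𝒞R hE𝒞 hx0 hx1 w
    _ = (x ^ d)⁻¹ := by simp

theorem exp_mul_pow_le_integral_ghostMoment [Nonempty ι] (hR : MeasurableSet R) {S : κ → Z}
    (hER : ∀ i, E i S ⊆ R) (hE : ∀ i, MeasurableSet (E i S)) (hx0 : 0 ≤ x) (hx1 : x ≤ 1)
    {b : ℝ} (hb : ∀ i, hits (E i S) S ≤ b) :
    Real.exp (-b - x * hits R S) *
        (1 + ((𝔼 i, D.real (E i S)) / 4 - D.real R * x)) ^ Fintype.card κ ≤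
      ∫ G, ghostMoment x R E S G ∂(Measure.pi fun _ => D) := by
  have hRx : D.real R * x ≤ 1 := mul_le_one₀ measureReal_le_one hx0 hx1
  have hnonneg (i : ι) : 0 ≤ 1 + (D.real (E i S) / 4 - D.real R * x) := by
    linarith [measureReal_nonneg (μ := D) (s := E i S)]
  have hbase (i : ι) : 1 + (D.real (E i S) / 4 - D.real R * x) ≤
      1 + ((1 + x)⁻¹ - 1) * D.real R + (1 + x)⁻¹ * (3 / 2 - 1) * D.real (E i S) := by
    have hinv : 1 / 2 ≤ (1 + x)⁻¹ := by
      rw [one_div]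
      exact inv_anti₀ (by positivity) (by linarith)
    have hinv' : 1 - x ≤ (1 + x)⁻¹ := by
      rw [← one_div, le_div_iff₀ (by positivity)]
      nlinarith
    nlinarith [measureReal_nonneg (μ := D) (s := E i S), measureReal_nonneg (μ := D) (s := R)]
  have hmean : 1 + ((𝔼 i, D.real (E i S)) / 4 - D.real R * x) =
      𝔼 i, (1 + (D.real (E i S) / 4 - D.real R * x)) := by
    rw [expect_add_distrib, expect_sub_distrib, ← expect_div, Fintype.expect_const,
      Fintype.expect_const]
  unfold ghostMoment
  rw [integral_expect fun i =>
    (integrable_pow_hits_mul_pow_hits D (hE i) hR (hER i) _ _).const_mul _, hmean]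
  refine (mul_le_mul_of_nonneg_left (pow_expect_le_expect_pow hnonneg _)
    (Real.exp_nonneg _)).trans ?_
  rw [mul_expect]
  refine expect_le_expect fun i _ => ?_
  rw [integral_const_mul, integral_pow_hits_mul_pow_hits D (hE i) hR (hER i)]
  have := hnonneg i
  have := hbase i
  gcongr
  exact exp_neg_le_half_pow_mul_inv_pow hx0 (hb i)

end Moment

theorem inv_pow_div_le_exp_mul_pow {d m n : ℕ} {x δ b p q : ℝ} (hn : 0 < n) (hx0 : 0 < x)
    (hx1 : x ≤ 1) (hδ0 : 0 < δ) (hδ1 : δ ≤ 1) (hb : 0 ≤ b) (hp : p ≤ 1) (hq : 0 ≤ q)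
    (hm : m ≤ 2 * n * q + Real.log (1 / δ))
    (hdev : 20 * q * x + 8 / n * (b + d * Real.log (1 / x) + 2 * Real.log (1 / δ)) < p) :
    (x ^ d)⁻¹ / δ ≤ Real.exp (-b - x * m) * (1 + (p / 4 - q * x)) ^ n := by
  have hn' : (0 : ℝ) < n := Nat.cast_pos.2 hn
  have hlx : 0 ≤ Real.log (1 / x) := Real.log_nonneg (one_le_one_div hx0 hx1)
  have hlδ : 0 ≤ Real.log (1 / δ) := Real.log_nonneg (one_le_one_div hδ0 hδ1)
  set B := b + d * Real.log (1 / x) + 2 * Real.log (1 / δ)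
  have hB0 : 0 ≤ B := by positivity
  have hqx : 0 ≤ q * x := by positivity
  have hu0 : 0 ≤ p / 4 - q * x := by
    linarith [mul_nonneg (by positivity : 0 ≤ 8 / (n : ℝ)) hB0]
  have hnp : 20 * (n * (q * x)) + 8 * B ≤ n * p := by
    calc 20 * (n * (q * x)) + 8 * B = n * (20 * q * x + 8 / n * B) := by field_simp
      _ ≤ n * p := by gcongr
  have hxm : x * m ≤ 2 * (n * (q * x)) + Real.log (1 / δ) := by
    nlinarith [mul_le_mul_of_nonneg_left hm hx0.le]
  calc (x ^ d)⁻¹ / δ = Real.exp (d * Real.log (1 / x) + Real.log (1 / δ)) := by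
        rw [Real.exp_add, Real.exp_nat_mul, Real.exp_log (by positivity),
          Real.exp_log (by positivity), one_div, inv_pow, one_div, div_eq_mul_inv]
    _ ≤ Real.exp ((-b - x * m) + n * ((p / 4 - q * x) / 2)) :=
        Real.exp_le_exp.2 (by linarith [mul_nonneg hn'.le hqx])
    _ = Real.exp (-b - x * m) * Real.exp ((p / 4 - q * x) / 2) ^ n := by
        rw [Real.exp_add, Real.exp_nat_mul]
    _ ≤ Real.exp (-b - x * m) * (1 + (p / 4 - q * x)) ^ n := by
        gcongr
        exact exp_half_le_one_add hu0 (by linarith)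

theorem measureReal_relative_deviation_le [Nonempty ι] [Nonempty κ] (D : Measure Z)
    [IsProbabilityMeasure D] {𝒞 : Set (Set Z)} {d : ℕ} (h𝒞 : VCDimLE 𝒞 d) {R : Set Z}
    (hR : MeasurableSet R) (h𝒞R : ∀ E ∈ 𝒞, E ⊆ R) {E : ι → (κ → Z) → Set Z}
    (hE𝒞 : ∀ i S, E i S ∈ 𝒞) (hE : ∀ i, MeasurableSet {p : (κ → Z) × Z | p.2 ∈ E i p.1})
    {x δ : ℝ} (hx0 : 0 < x) (hx1 : x ≤ 1) (hδ0 : 0 < δ) (hδ1 : δ ≤ 1)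
    {b : (κ → Z) → ℝ} (hb : ∀ S i, hits (E i S) S ≤ b S) :
    (Measure.pi fun _ : κ => D).real
      {S | 20 * D.real R * x +
          8 / Fintype.card κ * (b S + d * Real.log (1 / x) + 2 * Real.log (1 / δ)) <
        𝔼 i, D.real (E i S)} ≤ 2 * δ := by
  have hint := integrable_ghostMoment hR hE hx0.le
    ((Measure.pi fun _ : κ => D).prod (Measure.pi fun _ => D))
  have hmoment := integral_ghostMoment_le (D := D) h𝒞 h𝒞R hR hE𝒞 hE hx0 hx1
  rw [integral_prod _ hint] at hmoment
  have hghost := measureReal_div_le_le hint.integral_prod_left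
    (fun S => integral_nonneg fun G => ghostMoment_nonneg hx0.le _ _ _ _) (by positivity) hδ0
    hmoment
  have hhits := measureReal_lt_hits_le (κ := κ) D hR hδ0
  rw [two_mul δ]
  refine le_trans (measureReal_mono fun S hS => ?_)
    ((measureReal_union_le _ _).trans (add_le_add hghost hhits))
  refine or_iff_not_imp_right.2 fun hN => ?_
  refine (inv_pow_div_le_exp_mul_pow Fintype.card_pos hx0 hx1 hδ0 hδ1
    ((Nat.cast_nonneg _).trans (hb S (Classical.arbitrary ι)))
    (expect_le univ_nonempty fun i _ => measureReal_le_one) measureReal_nonneg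
    (not_lt.1 hN) hS).trans ?_
  exact exp_mul_pow_le_integral_ghostMoment hR (fun i => h𝒞R _ (hE𝒞 i S))
    (fun i => measurable_prodMk_left (hE i)) hx0.le hx1 (hb S)

end RelativeDeviation

section Conditional

variable {Z I ι : Type*} [MeasurableSpace Z] [Fintype I] [Fintype ι]

theorem measureReal_pi_le_of_forall_updateFinset [DecidableEq I] (D : Measure Z)
    [IsProbabilityMeasure D] (u : Finset I) {s : Set (I → Z)} (hs : MeasurableSet s) {c : ℝ}
    (hc : 0 ≤ c) (h : ∀ z : I → Z, (Measure.pi fun _ : u => D).real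
      {y : u → Z | Function.updateFinset z u y ∈ s} ≤ c) :
    (Measure.pi fun _ : I => D).real s ≤ c := by
  have hsection (z : I → Z) : (∫⋯∫⁻_u, s.indicator 1 ∂fun _ => D) z ≤
      (∫⋯∫⁻_u, fun _ => ENNReal.ofReal c ∂fun _ => D) z := by
    have hmeas : MeasurableSet {y : u → Z | Function.updateFinset z u y ∈ s} :=
      measurable_updateFinset hs
    simp only [lmarginal, lintegral_const, measure_univ, mul_one]
    refine le_of_eq_of_le (lintegral_indicator_one hmeas) ?_
    exact (ENNReal.le_ofReal_iff_toReal_le (measure_ne_top _ _) hc).2 (h z)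
  have hle := lintegral_le_of_lmarginal_le (μ := fun _ : I => D) u
    (measurable_one.indicator hs) measurable_const hsection
  rw [lintegral_indicator_one hs, lintegral_const, measure_univ, mul_one] at hle
  exact (ENNReal.le_ofReal_iff_toReal_le (measure_ne_top _ _) hc).1 hle

theorem measureReal_relative_deviation_inter_le [Nonempty ι] (D : Measure Z)
    [IsProbabilityMeasure D] {𝒞 : Set (Set Z)} {d : ℕ} (h𝒞 : VCDimLE 𝒞 d) {u : Finset I}
    (hu : u.Nonempty) {R : (I → Z) → Set Z} (hRu : DependsOn R (uᶜ : Set I))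
    (hR : MeasurableSet {p : (I → Z) × Z | p.2 ∈ R p.1}) {E : ι → (I → Z) → Set Z}
    (hE𝒞 : ∀ i z, E i z ∈ 𝒞) (hE : ∀ i, MeasurableSet {p : (I → Z) × Z | p.2 ∈ E i p.1})
    {x δ : ℝ} (hx0 : 0 < x) (hx1 : x ≤ 1) (hδ0 : 0 < δ) (hδ1 : δ ≤ 1)
    {b : (I → Z) → ℝ} (hb_meas : Measurable b)
    (hb : ∀ z i, hits (E i z) (u.restrict z) ≤ b z) :
    (Measure.pi fun _ : I => D).real
      {z | 20 * D.real (R z) * x +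
          8 / #u * (b z + d * Real.log (1 / x) + 2 * Real.log (1 / δ)) <
        𝔼 i, D.real (E i z ∩ R z)} ≤ 2 * δ := by
  classical
  have hDR : Measurable fun z => D.real (R z) :=
    (measurable_measure_prodMk_left hR).ennreal_toReal
  have hDE (i : ι) : Measurable fun z => D.real (E i z ∩ R z) :=
    (measurable_measure_prodMk_left ((hE i).inter hR)).ennreal_toReal
  refine measureReal_pi_le_of_forall_updateFinset D u (measurableSet_lt (by fun_prop) ?_)
    (by positivity) fun z => ?_
  · simp only [Fintype.expect_eq_sum_div_card]
    exact (Finset.measurable_sum _ fun i _ => hDE i).div_const _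
  have hRz (y : u → Z) : R (Function.updateFinset z u y) = R z :=
    hRu fun i hi => dif_neg hi
  have hEz (i : ι) : MeasurableSet
      {p : (u → Z) × Z | p.2 ∈ E i (Function.updateFinset z u p.1) ∩ R z} :=
    (((measurable_updateFinset.comp measurable_fst).prodMk measurable_snd) (hE i)).inter
      (measurable_snd (measurable_prodMk_left hR))
  have : Nonempty u := hu.to_subtype
  have hdev := measureReal_relative_deviation_le D (R := R z) (h𝒞.image_inter (R z))
    (measurable_prodMk_left hR)
    (Set.forall_mem_image.2 fun _ _ => Set.inter_subset_right)
    (fun i y => ⟨_, hE𝒞 i (Function.updateFinset z u y), rfl⟩) hEz hx0 hx1 hδ0 hδ1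
    (b := fun y => b (Function.updateFinset z u y)) fun y i =>
      (Nat.cast_le.2 (hits_mono Set.inter_subset_left y)).trans
        ((hb (Function.updateFinset z u y) i).trans' (by rw [Function.restrict_updateFinset]))
  simpa only [Set.mem_ofPred_eq, hRz, Fintype.card_coe] using hdev

end Conditional

section Splitting

variable {Z W : Type*}

/-- The sequence `S_{j,⊔}` on which the `j`-th recursive call of the splitting algorithm runs. -/
def activeBlock (k : ℕ) (S : List Z) (j : ℕ) : List Z :=
  (block S (3 ^ (k + 3)) j).take (3 ^ k)

/-- The sequence `S_{j,⊓}` that the `j`-th recursive call of the splitting algorithm adds to all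
of its training sequences. -/
def reservedBlock (k : ℕ) (S : List Z) (j : ℕ) : List Z :=
  (block S (3 ^ (k + 3)) j).drop (3 ^ k)

theorem splits_add_six (k : ℕ) (S T : List Z) :
    splits (k + 6) S T = (List.range 27).flatMap fun j =>
      splits k (activeBlock k S j) (reservedBlock k S j ++ T) := rfl

theorem splits_of_lt_six {k : ℕ} (hk : k < 6) (S T : List Z) : splits k S T = [S ++ T] := by
  interval_cases k <;> rfl

theorem induction_six {P : ℕ → Prop} (lt_six : ∀ k < 6, P k) (add_six : ∀ k, P k → P (k + 6))
    (k : ℕ) : P k := by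
  induction k using Nat.strong_induction_on with
  | _ k ih =>
    obtain hk | hk := lt_or_ge k 6
    · exact lt_six k hk
    · obtain ⟨l, rfl⟩ := Nat.exists_eq_add_of_le' hk
      exact add_six l (ih l (by lia))

theorem activeBlock_append_reservedBlock (k : ℕ) (S : List Z) (j : ℕ) :
    activeBlock k S j ++ reservedBlock k S j = block S (3 ^ (k + 3)) j :=
  List.take_append_drop _ _

theorem reservedBlock_sublist_block (k : ℕ) (S : List Z) (j : ℕ) :
    (reservedBlock k S j).Sublist (block S (3 ^ (k + 3)) j) :=
  List.drop_sublist _ _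

theorem map_block (f : Z → W) (S : List Z) (b j : ℕ) :
    (block S b j).map f = block (S.map f) b j := by
  simp only [block, List.map_take, List.map_drop]

theorem map_activeBlock (f : Z → W) (k : ℕ) (S : List Z) (j : ℕ) :
    (activeBlock k S j).map f = activeBlock k (S.map f) j := by
  simp only [activeBlock, List.map_take, map_block]

theorem map_reservedBlock (f : Z → W) (k : ℕ) (S : List Z) (j : ℕ) :
    (reservedBlock k S j).map f = reservedBlock k (S.map f) j := by
  simp only [reservedBlock, List.map_drop, map_block]

theorem map_splits (f : Z → W) (k : ℕ) (S T : List Z) :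
    (splits k S T).map (List.map f) = splits k (S.map f) (T.map f) := by
  induction k using induction_six generalizing S T with
  | lt_six k hk => simp [splits_of_lt_six hk]
  | add_six k ih =>
    simp only [splits_add_six, List.map_flatMap, ih, List.map_append, map_activeBlock,
      map_reservedBlock]

theorem length_splits (k : ℕ) (S T : List Z) : (splits k S T).length = 27 ^ (k / 6) := by
  induction k using induction_six generalizing S T with
  | lt_six k hk => simp [splits_of_lt_six hk, Nat.div_eq_of_lt hk]
  | add_six k ih =>
    rw [splits_add_six, List.length_flatMap, Nat.add_div_right k (by simp)]
    simp only [ih, List.map_const', List.length_range, List.sum_replicate, smul_eq_mul, pow_succ']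

theorem block_sublist (S : List Z) (b j : ℕ) : (block S b j).Sublist S :=
  (List.take_sublist _ _).trans (List.drop_sublist _ _)

theorem activeBlock_append_reservedBlock_append_sublist (k : ℕ) (S T : List Z) (j : ℕ) :
    (activeBlock k S j ++ (reservedBlock k S j ++ T)).Sublist (S ++ T) := by
  rw [← List.append_assoc, activeBlock_append_reservedBlock]
  exact (block_sublist _ _ _).append_right _

theorem subset_of_mem_splits {k : ℕ} {S T L : List Z} (hL : L ∈ splits k S T) : T ⊆ L := by
  induction k using induction_six generalizing S T with
  | lt_six k hk =>
    rw [splits_of_lt_six hk, List.mem_singleton] at hL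
    exact hL ▸ List.subset_append_right _ _
  | add_six k ih =>
    obtain ⟨j, -, hj⟩ := List.mem_flatMap.1 hL
    exact List.Subset.trans (List.subset_append_right _ _) (ih hj)

theorem subperm_of_mem_splits {k : ℕ} {S T L : List Z} (hL : L ∈ splits k S T) :
    L.Subperm (S ++ T) := by
  induction k using induction_six generalizing S T with
  | lt_six k hk =>
    rw [splits_of_lt_six hk, List.mem_singleton] at hL
    exact hL ▸ List.Subperm.refl _
  | add_six k ih =>
    obtain ⟨j, -, hj⟩ := List.mem_flatMap.1 hL
    exact (ih hj).trans (activeBlock_append_reservedBlock_append_sublist k S T j).subperm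

theorem length_block {S : List Z} {b j n : ℕ} (hS : S.length = n * b) (hj : j < n) :
    (block S b j).length = b := by
  have hjb : (j + 1) * b ≤ n * b := Nat.mul_le_mul_right _ hj
  rw [add_one_mul] at hjb
  simp only [block, List.length_take, List.length_drop]
  lia

section Length

variable {k j : ℕ} {S : List Z} (hS : S.length = 3 ^ (k + 6)) (hj : j < 27)

include hS hj

theorem length_block_of_length_eq : (block S (3 ^ (k + 3)) j).length = 27 * 3 ^ k :=
  (length_block (hS.trans (by ring)) hj).trans (by ring)

theorem length_activeBlock : (activeBlock k S j).length = 3 ^ k := by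
  rw [activeBlock, List.length_take, length_block_of_length_eq hS hj]
  lia

theorem length_reservedBlock : (reservedBlock k S j).length = 26 * 3 ^ k := by
  rw [reservedBlock, List.length_drop, length_block_of_length_eq hS hj]
  lia

end Length

theorem disjoint_block {S : List Z} (hS : S.Nodup) {b i j : ℕ} (hij : i ≠ j) :
    (block S b i).Disjoint (block S b j) := by
  wlog hlt : i < j generalizing i j
  · exact (this hij.symm (by lia)).symm
  have hle : (i + 1) * b ≤ j * b := Nat.mul_le_mul_right _ hlt
  have hi : block S b i ⊆ S.take ((i + 1) * b) := by
    rw [block, List.take_drop, add_one_mul]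
    exact List.drop_subset _ _
  exact List.disjoint_of_subset_left hi <| List.disjoint_of_subset_right (List.take_subset _ _) <|
    List.disjoint_take_drop hS hle

theorem disjoint_reservedBlock {S T : List Z} (hST : (S ++ T).Nodup) (k : ℕ) {i j : ℕ}
    (hij : i ≠ j) :
    (activeBlock k S i ++ (reservedBlock k S i ++ T)).Disjoint (reservedBlock k S j) := by
  obtain ⟨hS, -, hdisj⟩ := List.nodup_append'.1 hST
  have hj := (reservedBlock_sublist_block k S j).subset
  rw [← List.append_assoc, activeBlock_append_reservedBlock, List.disjoint_append_left]
  exact ⟨List.disjoint_of_subset_right hj (disjoint_block hS hij),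
    (List.disjoint_of_subset_left (List.Subset.trans hj (block_sublist _ _ _).subset) hdisj).symm⟩

end Splitting

section Errors

theorem countP_ofFn {Z : Type*} {n : ℕ} (p : Z → Bool) (w : Fin n → Z) :
    (List.ofFn w).countP p = hits {z | p z} w := by
  classical
  induction n with
  | zero => simp [hits, trace]
  | succ n ih =>
    have hcons := Fin.card_filter_univ_succ fun i => (p (w i) : Prop)
    simp only [List.ofFn_succ, List.countP_cons, ih, hits, trace, Set.mem_ofPred_eq]
    rw [hcons]
    split_ifs <;> rfl

theorem map_eq_ofFn {J Z : Type*} (w : J → Z) (l : List J) :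
    l.map w = List.ofFn fun i : Fin l.length => w l[i] := by
  conv_lhs => rw [← List.ofFn_getElem (xs := l), List.map_ofFn]
  rfl

theorem countP_map_eq_hits {J Z : Type*} (p : Z → Bool) (w : J → Z) (l : List J) :
    (l.map w).countP p = hits {z | p z} fun i : Fin l.length => w l[i] := by
  rw [map_eq_ofFn, countP_ofFn]

variable {X I J : Type*}

/-- The number of examples of `S` that `h` misclassifies. -/
def errorCount (h : Hypothesis X) (S : List (Example X)) : ℕ :=
  S.countP fun z => decide (h z.1 ≠ z.2)

theorem errorCount_ofFn {n : ℕ} (h : Hypothesis X) (S : Fin n → Example X) :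
    errorCount h (List.ofFn S) = hits (errorSet h) S := by
  simp only [errorCount, countP_ofFn, decide_eq_true_eq, errorSet]

theorem errorCount_map (h : Hypothesis X) (z : I → Example X) (l : List I) :
    errorCount h (l.map z) = hits (errorSet h) fun i : Fin l.length => z l[i] := by
  rw [map_eq_ofFn, errorCount_ofFn]

theorem errorCount_map_le_of_subperm (h : Hypothesis X) (z : I → Example X) {l l' : List I}
    (hl : l.Subperm l') : errorCount h (l.map z) ≤ errorCount h (l'.map z) := by
  simp only [errorCount, List.countP_map]
  exact hl.countP_le _

theorem hits_restrict_le_errorCount_map [DecidableEq I] (h : Hypothesis X) (z : I → Example X)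
    {v l : List I} (hvl : v ⊆ l) :
    hits (errorSet h) (v.toFinset.restrict z) ≤ errorCount h (l.map z) := by
  have hmem (i : v.toFinset) : ∃ a : Fin l.length, l[a] = i :=
    List.mem_iff_get.1 (hvl (List.mem_toFinset.1 i.2))
  choose f hf using hmem
  have hf_inj : f.Injective := fun i j hij => Subtype.ext (by rw [← hf, ← hf, hij])
  rw [errorCount_map]
  have hle := hits_comp_le_of_injective (errorSet h) (fun a : Fin l.length => z l[a]) hf_inj
  simp only [hf] at hle
  exact hle

theorem IsERM.errorCount_le {H : Set (Hypothesis X)} {A : Learner X} (hA : IsERM H A)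
    {h : Hypothesis X} (hh : h ∈ H) (S : List (Example X)) :
    errorCount (A S) S ≤ errorCount h S := by
  obtain rfl | hS := eq_or_ne S []
  · simp [errorCount]
  have hlen : (0 : ℝ) < S.length := by simpa [List.length_pos_iff] using hS
  exact_mod_cast (div_le_div_iff_of_pos_right hlen).1 ((hA S).2 h hh)

theorem avgNe_nonneg (F : List (Hypothesis X)) (z : Example X) : 0 ≤ avgNe F z := by
  unfold avgNe
  positivity

theorem avgNe_le_one (F : List (Hypothesis X)) (z : Example X) : avgNe F z ≤ 1 :=
  div_le_one_of_le₀ (mod_cast List.countP_le_length) (Nat.cast_nonneg _)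

theorem avgNe_map (F : List J) (g : J → Hypothesis X) (z : Example X) :
    avgNe (F.map g) z = 𝔼 i : Fin F.length, (errorSet (g F[i])).indicator 1 z := by
  rw [avgNe, countP_map_eq_hits, cast_hits, Fintype.expect_eq_sum_div_card, List.length_map,
    Fintype.card_fin]
  simp [Set.indicator_apply, errorSet]

theorem avgNe_flatMap_range {n M : ℕ} {G : ℕ → List (Hypothesis X)}
    (hG : ∀ j, (G j).length = M) (z : Example X) :
    avgNe ((List.range n).flatMap G) z = 𝔼 j ∈ range n, avgNe (G j) z := by
  have hcount : ((List.range n).flatMap G).countP (fun h => decide (h z.1 ≠ z.2)) =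
      ∑ j ∈ range n, (G j).countP fun h => decide (h z.1 ≠ z.2) := List.countP_flatMap
  have hlength : ((List.range n).flatMap G).length = n * M := by
    simp [List.length_flatMap, hG]
  simp only [avgNe, hcount, hlength, hG, expect_eq_sum_div_card, ← sum_div, card_range]
  push_cast
  rw [div_div, mul_comm]

variable [MeasurableSpace X]

theorem measurableSet_errorSet {α : Type*} [MeasurableSpace α] {h : α → Hypothesis X}
    {f : α → Example X} (hf : Measurable f) (hh : Measurable fun a => h a (f a).1) :
    MeasurableSet {a | f a ∈ errorSet (h a)} :=
  (measurableSet_eq_fun hh hf.snd).compl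

theorem IsMeasurableLearner.measurableSet_errorSet_map {A : Learner X}
    (hA : IsMeasurableLearner A) (l : List I) :
    MeasurableSet {p : (I → Example X) × Example X | p.2 ∈ errorSet (A (l.map p.1))} := by
  have hsample : Measurable fun p : (I → Example X) × Example X =>
      (fun i : Fin l.length => p.1 l[i], p.2.1) := by fun_prop
  simp only [map_eq_ofFn]
  exact measurableSet_errorSet measurable_snd ((hA l.length).comp hsample)

theorem IsMeasurableLearner.measurableSet_errorSet {A : Learner X} (hA : IsMeasurableLearner A)
    (S : List (Example X)) : MeasurableSet (errorSet (A S)) := by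
  simpa using measurable_prodMk_left (x := S.get) (hA.measurableSet_errorSet_map (List.finRange _))

theorem measurable_errorCount_map {h : Hypothesis X} (hh : Measurable h) (l : List I) :
    Measurable fun z : I → Example X => errorCount h (l.map z) := by
  simp only [errorCount_map]
  exact measurable_hits_comp fun i =>
    measurableSet_errorSet (measurable_pi_apply _) (hh.comp (measurable_pi_apply _).fst)

theorem IsMeasurableLearner.measurable_avgNe_map {A : Learner X} (hA : IsMeasurableLearner A)
    (F : List (List I)) : Measurable fun p : (I → Example X) × Example X =>
      avgNe (F.map fun l => A (l.map p.1)) p.2 := by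
  classical
  simp only [avgNe_map, Fintype.expect_eq_sum_div_card, Set.indicator_apply, Pi.one_apply]
  exact (Finset.measurable_sum _ fun i _ => Measurable.ite (hA.measurableSet_errorSet_map F[i])
    measurable_const measurable_const).div_const _

end Errors

section Voting

theorem card_mul_sub_one_le_sum_offDiag {J : Type*} {s : Finset J} {a : J → ℝ}
    (ha0 : ∀ j ∈ s, 0 ≤ a j) (ha1 : ∀ j ∈ s, a j ≤ 1) {α : ℝ} (hα : α ≤ 𝔼 j ∈ s, a j) :
    #s * α - 1 ≤ ∑ p ∈ s.offDiag, if α ≤ a p.1 then a p.2 else 0 := by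
  classical
  have hnonneg : ∀ p ∈ s.offDiag, 0 ≤ if α ≤ a p.1 then a p.2 else 0 := fun p hp => by
    split_ifs
    exacts [ha0 _ (mem_offDiag.1 hp).2.1, le_rfl]
  obtain rfl | hs := s.eq_empty_or_nonempty
  · simp
  obtain ⟨j, hj, hαj⟩ := exists_le_of_le_expect hs hα
  calc #s * α - 1 ≤ #s * (𝔼 l ∈ s, a l) - a j := by
        gcongr
        exact ha1 j hj
    _ = ∑ l ∈ s.erase j, a l := by
        rw [card_mul_expect, ← add_sum_erase s a hj, add_sub_cancel_left]
    _ = ∑ p ∈ (s.erase j).map ⟨Prod.mk j, Prod.mk_right_injective j⟩,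
          if α ≤ a p.1 then a p.2 else 0 := by
        simp only [sum_map, Function.Embedding.coeFn_mk, hαj, if_true]
    _ ≤ ∑ p ∈ s.offDiag, if α ≤ a p.1 then a p.2 else 0 := by
        refine sum_le_sum_of_subset_of_nonneg (fun p hp => ?_) fun p hp _ => hnonneg p hp
        obtain ⟨l, hl, rfl⟩ := mem_map.1 hp
        exact mem_offDiag.2 ⟨hj, mem_of_mem_erase hl, (ne_of_mem_erase hl).symm⟩

variable {X : Type*}

/-- The set of examples on which at least an `α`-fraction of the hypotheses in `F` err; its
probability is `fractionError D α F`. -/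
def fractionErrorSet (α : ℝ) (F : List (Hypothesis X)) : Set (Example X) :=
  {z | α ≤ avgNe F z}

variable [MeasurableSpace X]

/-- The probability that, on a new example drawn from `D`, at least an `α`-fraction of the
hypotheses in `F` err and a uniformly random member of `G` errs as well. -/
noncomputable def jointError (D : Measure (Example X)) (α : ℝ) (F G : List (Hypothesis X)) : ℝ :=
  ∫ z in fractionErrorSet α F, avgNe G z ∂D

theorem fractionError_flatMap_range_le (D : Measure (Example X)) [IsProbabilityMeasure D]
    {n M : ℕ} {G : ℕ → List (Hypothesis X)} (hlength : ∀ j, (G j).length = M)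
    (hG : ∀ j, Measurable (avgNe (G j))) (α : ℝ) :
    (n * α - 1) * fractionError D α ((List.range n).flatMap G) ≤
      ∑ p ∈ (range n).offDiag, jointError D α (G p.1) (G p.2) := by
  classical
  have hmeas (j : ℕ) : MeasurableSet (fractionErrorSet α (G j)) :=
    measurableSet_le measurable_const (hG j)
  have hflat : MeasurableSet (fractionErrorSet α ((List.range n).flatMap G)) := by
    refine measurableSet_le measurable_const ?_
    rw [funext (avgNe_flatMap_range hlength)]
    simp only [expect_eq_sum_div_card]
    exact (Finset.measurable_sum _ fun j _ => hG j).div_const _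
  have hint (p : ℕ × ℕ) :
      Integrable ((fractionErrorSet α (G p.1)).indicator (avgNe (G p.2))) D :=
    (Integrable.of_bound (hG _).aestronglyMeasurable 1 (.of_forall fun z => by
      rw [Real.norm_of_nonneg (avgNe_nonneg _ _)]
      exact avgNe_le_one _ _)).indicator (hmeas _)
  calc _ = ∫ z, (fractionErrorSet α ((List.range n).flatMap G)).indicator
          (fun _ => n * α - 1) z ∂D := by
        rw [integral_indicator_const _ hflat, smul_eq_mul, mul_comm]
        rfl
    _ ≤ ∫ z, ∑ p ∈ (range n).offDiag,
          (fractionErrorSet α (G p.1)).indicator (avgNe (G p.2)) z ∂D := by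
        refine integral_mono ((integrable_const _).indicator hflat)
          (integrable_finsetSum _ fun p _ => hint p) (Set.indicator_le' (fun z hz => ?_) fun z _ =>
            sum_nonneg fun p _ => Set.indicator_nonneg (fun z _ => avgNe_nonneg _ z) z)
        have hα : α ≤ 𝔼 j ∈ range n, avgNe (G j) z := by
          rw [← avgNe_flatMap_range hlength]
          exact hz
        simpa only [card_range, Set.indicator_apply, fractionErrorSet, Set.mem_ofPred_eq] using
          card_mul_sub_one_le_sum_offDiag (fun j _ => avgNe_nonneg (G j) z)
            (fun j _ => avgNe_le_one (G j) z) hα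
    _ = _ := by
        rw [integral_finsetSum _ fun p _ => hint p]
        exact sum_congr rfl fun p _ => integral_indicator (hmeas p.1)

theorem setIntegral_avgNe_map (D : Measure (Example X)) [IsFiniteMeasure D] {J : Type*}
    {F : List J} {g : J → Hypothesis X} (hg : ∀ j ∈ F, MeasurableSet (errorSet (g j)))
    (R : Set (Example X)) :
    ∫ z in R, avgNe (F.map g) z ∂D = 𝔼 i : Fin F.length, D.real (errorSet (g F[i]) ∩ R) := by
  have hg' (i : Fin F.length) : MeasurableSet (errorSet (g F[i])) := hg _ (List.getElem_mem i.2)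
  simp only [avgNe_map]
  rw [integral_expect (f := fun i => (errorSet (g F[i])).indicator 1)
    fun i => (integrable_const (1 : ℝ)).indicator (hg' i)]
  refine expect_congr rfl fun i _ => ?_
  rw [integral_indicator_one (hg' i), measureReal_restrict_apply (hg' i)]

end Voting

section BlockFamilies

variable {X I : Type*}

theorem ermFamily_map (A : Learner X) (k : ℕ) (s t : List I) (z : I → Example X) :
    ermFamily A k (s.map z) (t.map z) = (splits k s t).map fun l => A (l.map z) := by
  rw [ermFamily, ← map_splits, List.map_map]
  rfl

/-- The part of the family `𝒜(S; T)` that comes from the `j`-th recursive call of the splitting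
algorithm, where `|S| = 3 ^ (k + 6)`. -/
def blockFamily (A : Learner X) (k : ℕ) (S T : List (Example X)) (j : ℕ) :
    List (Hypothesis X) :=
  ermFamily A k (activeBlock k S j) (reservedBlock k S j ++ T)

theorem ermFamily_add_six (A : Learner X) (k : ℕ) (S T : List (Example X)) :
    ermFamily A (k + 6) S T = (List.range 27).flatMap (blockFamily A k S T) :=
  List.map_flatMap

theorem length_blockFamily (A : Learner X) (k : ℕ) (S T : List (Example X)) (j : ℕ) :
    (blockFamily A k S T j).length = 27 ^ (k / 6) := by
  rw [blockFamily, ermFamily, List.length_map, length_splits]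

theorem blockFamily_map (A : Learner X) (k : ℕ) (s t : List I) (z : I → Example X) (j : ℕ) :
    blockFamily A k (s.map z) (t.map z) j =
      (splits k (activeBlock k s j) (reservedBlock k s j ++ t)).map fun l => A (l.map z) := by
  rw [blockFamily, ← map_activeBlock, ← map_reservedBlock, ← List.map_append, ermFamily_map]

theorem dependsOn_map_map (A : Learner X) {F : List (List I)} {u : Set I}
    (hF : ∀ l ∈ F, ∀ i ∈ l, i ∈ u) :
    DependsOn (fun z : I → Example X => F.map fun l => A (l.map z)) u := fun _ _ hzz' =>
  List.map_congr_left fun l hl =>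
    congrArg A (List.map_congr_left fun i hi => hzz' i (hF l hl i hi))

variable [MeasurableSpace X]

theorem IsMeasurableLearner.measurable_avgNe_blockFamily {A : Learner X}
    (hA : IsMeasurableLearner A) (k : ℕ) (S T : List (Example X)) (j : ℕ) :
    Measurable (avgNe (blockFamily A k S T j)) := by
  have hmap := blockFamily_map A k S T id j
  have hmeas := (hA.measurable_avgNe_map (splits k (activeBlock k S j)
    (reservedBlock k S j ++ T))).comp (measurable_prodMk_left (x := id))
  rw [List.map_id, List.map_id] at hmap
  rw [hmap]
  exact hmeas

theorem measureReal_setIntegral_avgNe_le [Fintype I] (D : Measure (Example X))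
    [IsProbabilityMeasure D] {H : Set (Hypothesis X)} {d : ℕ} (hd : vcDim H ≤ d) {A : Learner X}
    (hA : IsERM H A) (hAm : IsMeasurableLearner A) {h : Hypothesis X} (hh : h ∈ H)
    (hhm : Measurable h) {F : List (List I)} (hF : F ≠ []) {v w : List I} (hv : v.Nodup)
    (hv_ne : v ≠ []) (hvF : ∀ l ∈ F, v ⊆ l) (hFw : ∀ l ∈ F, l.Subperm w)
    {R : (I → Example X) → Set (Example X)} (hRv : DependsOn R {i | i ∉ v})
    (hR : MeasurableSet {p : (I → Example X) × Example X | p.2 ∈ R p.1})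
    {x δ : ℝ} (hx0 : 0 < x) (hx1 : x ≤ 1) (hδ0 : 0 < δ) (hδ1 : δ ≤ 1) :
    (Measure.pi fun _ : I => D).real
      {z | 20 * D.real (R z) * x + 8 / v.length *
          (errorCount h (w.map z) + d * Real.log (1 / x) + 2 * Real.log (1 / δ)) <
        ∫ e in R z, avgNe (F.map fun l => A (l.map z)) e ∂D} ≤ 2 * δ := by
  classical
  have : Nonempty (Fin F.length) := Fin.pos_iff_nonempty.1 (List.length_pos_iff.2 hF)
  simp only [setIntegral_avgNe_map D fun l _ => hAm.measurableSet_errorSet (List.map _ l),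
    ← List.toFinset_card_of_nodup hv]
  refine measureReal_relative_deviation_inter_le D (vcDimLE_errorSet hd)
    (List.toFinset_nonempty_iff _ |>.2 hv_ne) ?_ hR
    (fun i z => Set.mem_image_of_mem _ (hA _).1)
    (fun i => hAm.measurableSet_errorSet_map F[i]) hx0 hx1 hδ0 hδ1
    (Measurable.of_discrete.comp (measurable_errorCount_map hhm w)) fun z i => ?_
  · simpa [Set.compl_def] using hRv
  have hmem : F[i] ∈ F := List.getElem_mem i.2
  exact_mod_cast (hits_restrict_le_errorCount_map _ z (hvF _ hmem)).trans
    ((hA.errorCount_le hh _).trans (errorCount_map_le_of_subperm h z (hFw _ hmem)))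

theorem measureReal_jointError_blockFamily_le [Fintype I] (D : Measure (Example X))
    [IsProbabilityMeasure D] {H : Set (Hypothesis X)} {d : ℕ} (hd : vcDim H ≤ d) {A : Learner X}
    (hA : IsERM H A) (hAm : IsMeasurableLearner A) {h : Hypothesis X} (hh : h ∈ H)
    (hhm : Measurable h) {k : ℕ} {s t : List I} (hst : (s ++ t).Nodup)
    (hs : s.length = 3 ^ (k + 6)) {i j : ℕ} (hij : i ≠ j) (hj : j < 27) (α : ℝ)
    {x δ : ℝ} (hx0 : 0 < x) (hx1 : x ≤ 1) (hδ0 : 0 < δ) (hδ1 : δ ≤ 1) :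
    (Measure.pi fun _ : I => D).real
      {z | 20 * fractionError D α (blockFamily A k (s.map z) (t.map z) i) * x + 8 / (26 * 3 ^ k) *
          (errorCount h ((s ++ t).map z) + d * Real.log (1 / x) + 2 * Real.log (1 / δ)) <
        jointError D α (blockFamily A k (s.map z) (t.map z) i)
          (blockFamily A k (s.map z) (t.map z) j)} ≤ 2 * δ := by
  have hlength := length_reservedBlock hs hj
  have hsub := activeBlock_append_reservedBlock_append_sublist k s t
  simp only [blockFamily_map]
  have hbound := measureReal_setIntegral_avgNe_le D hd hA hAm hh hhm
    (F := splits k (activeBlock k s j) (reservedBlock k s j ++ t)) (v := reservedBlock k s j)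
    (w := s ++ t) (R := fun z => fractionErrorSet α
      ((splits k (activeBlock k s i) (reservedBlock k s i ++ t)).map fun l => A (l.map z)))
    ?_ ?_ ?_ ?_ ?_ ?_ ?_ hx0 hx1 hδ0 hδ1
  · rw [hlength] at hbound
    exact_mod_cast hbound
  · rw [← List.length_pos_iff, length_splits]
    positivity
  · exact (hst.sublist (hsub j)).sublist
      ((List.sublist_append_left _ _).trans (List.sublist_append_right _ _))
  · rw [← List.length_pos_iff, hlength]
    positivity
  · exact fun l hl => List.Subset.trans (List.subset_append_left _ _) (subset_of_mem_splits hl)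
  · exact fun l hl => (subperm_of_mem_splits hl).trans (hsub j).subperm
  · refine fun z z' hzz' => congrArg _ (dependsOn_map_map A (fun l hl a ha => ?_) hzz')
    exact disjoint_reservedBlock hst k hij ((subperm_of_mem_splits hl).subset ha)
  · exact measurableSet_le measurable_const (hAm.measurable_avgNe_map _)

end BlockFamilies

section SplittingError

variable {X I : Type*} {d : ℕ} {δ : ℝ}

theorem log_exp_one_div_div {c : ℝ} (hδ : 0 < δ) (hc : 0 < c) :
    Real.log (Real.exp 1 / (δ / c)) = 1 + Real.log (1 / δ) + Real.log c := by
  rw [show Real.exp 1 / (δ / c) = Real.exp 1 * (1 / δ) * c by field_simp,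
    Real.log_mul (by positivity) hc.ne', Real.log_mul (by positivity) (by positivity),
    Real.log_exp]

theorem log_one_div_div {c : ℝ} (hδ : 0 < δ) (hc : 0 < c) :
    Real.log (1 / (δ / c)) = Real.log (1 / δ) + Real.log c := by
  rw [show 1 / (δ / c) = 1 / δ * c by field_simp, Real.log_mul (by positivity) hc.ne']

theorem log_exp_one_div (hδ : 0 < δ) : Real.log (Real.exp 1 / δ) = 1 + Real.log (1 / δ) := by
  simpa using log_exp_one_div_div hδ one_pos

theorem log_one_div_nonneg (hδ0 : 0 < δ) (hδ1 : δ ≤ 1) : 0 ≤ Real.log (1 / δ) :=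
  Real.log_nonneg (one_le_one_div hδ0 hδ1)

theorem log_le_mul_of_le_two_pow {y : ℝ} {n : ℕ} (hy : 0 < y) (hyn : y ≤ 2 ^ n) :
    Real.log y ≤ 0.7 * n := by
  calc Real.log y ≤ Real.log (2 ^ n) := Real.log_le_log hy hyn
    _ = Real.log 2 * n := by rw [Real.log_pow, mul_comm]
    _ ≤ 0.7 * n := by
        gcongr
        exact Real.log_two_lt_d9.le.trans (by norm_num)

/-- The bound on the error of the splitting algorithm that is propagated through its recursion,
for sequences `S` and `T` with `|S| = 3 ^ k` on which the comparison hypothesis makes `n` errors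
in total, with confidence `1 - δ`. -/
noncomputable def splitBound (n d k : ℕ) (δ : ℝ) : ℝ :=
  10 ^ 9 * (n + d + Real.log (Real.exp 1 / δ)) / 3 ^ k

theorem one_le_splitBound {n k : ℕ} (hk : k < 6) (hδ0 : 0 < δ) (hδ1 : δ ≤ 1) :
    1 ≤ splitBound n d k δ := by
  have hlog := log_one_div_nonneg hδ0 hδ1
  have hpow : (3 : ℝ) ^ k ≤ 3 ^ 6 := pow_le_pow_right₀ (by norm_num) hk.le
  rw [splitBound, log_exp_one_div hδ0, one_le_div (by positivity)]
  linarith [n.cast_nonneg (α := ℝ), d.cast_nonneg (α := ℝ)]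

theorem splitBound_mono {m n k : ℕ} (hmn : m ≤ n) : splitBound m d k δ ≤ splitBound n d k δ := by
  unfold splitBound
  gcongr

/-- The right-hand side of the bound on the joint error of two of the families that the splitting
algorithm produces from sequences `S` and `T` with `|S| = 3 ^ (k + 6)`, where `q` is the error of
the first family and `n` the number of errors of the comparison hypothesis on `S` and `T`. -/
noncomputable def jointBound (q : ℝ) (n d k : ℕ) (δ : ℝ) : ℝ :=
  20 * q * (1 / 10 ^ 10) + 8 / (26 * 3 ^ k) *
    (n + d * Real.log (1 / (1 / 10 ^ 10)) + 2 * Real.log (1 / δ))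

-- `6318 = 9 * (27 * 26)`. The recursion spends half of `δ` on the 27 block families and half on
-- their 702 ordered pairs, whose bounds fail with probability `2 * (δ / 2808)` each.
theorem jointBound_le {q : ℝ} {n k : ℕ} (hδ0 : 0 < δ) (hδ1 : δ ≤ 1)
    (hq : q ≤ splitBound n d k (δ / 54)) :
    6318 * jointBound q n d k (δ / 2808) ≤ splitBound n d (k + 6) δ := by
  have hlog := log_one_div_nonneg hδ0 hδ1
  have hlog54 := log_le_mul_of_le_two_pow (y := 54) (n := 6) (by norm_num) (by norm_num)
  have hlog2808 := log_le_mul_of_le_two_pow (y := 2808) (n := 12) (by norm_num) (by norm_num)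
  have hlogx := log_le_mul_of_le_two_pow (y := 1 / (1 / 10 ^ 10)) (n := 40)
    (by norm_num) (by norm_num)
  have hdlogx := mul_le_mul_of_nonneg_left hlogx d.cast_nonneg
  push_cast at hlog54 hlog2808 hdlogx
  rw [splitBound, log_exp_one_div_div hδ0 (by norm_num)] at hq
  rw [jointBound, splitBound, log_one_div_div hδ0 (by norm_num), log_exp_one_div hδ0]
  set ℓ := Real.log (1 / δ)
  have hq' : q ≤ 10 ^ 9 * (n + d + (1 + ℓ + 0.7 * 6)) / 3 ^ k := hq.trans (by gcongr)
  calc _ ≤ 6318 * (20 * (10 ^ 9 * (n + d + (1 + ℓ + 0.7 * 6)) / 3 ^ k) * (1 / 10 ^ 10) +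
        8 / (26 * 3 ^ k) * (n + d * (0.7 * 40) + 2 * (ℓ + 0.7 * 12))) := by gcongr
    _ = 6318 * (2 * (n + d + (1 + ℓ + 0.7 * 6)) +
        8 / 26 * (n + d * (0.7 * 40) + 2 * (ℓ + 0.7 * 12))) / 3 ^ k := by
          field_simp
          ring
    _ ≤ 10 ^ 9 / 3 ^ 6 * (n + d + (1 + ℓ)) / 3 ^ k := by
        refine div_le_div_of_nonneg_right ?_ (by positivity)
        linarith [n.cast_nonneg (α := ℝ), d.cast_nonneg (α := ℝ)]
    _ = 10 ^ 9 * (n + d + (1 + ℓ)) / 3 ^ (k + 6) := by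
        rw [pow_add]
        field_simp

theorem splitBound_half_le {n k m : ℕ} (hm : m = 3 ^ k) {τ : ℝ} (hτ : 0 ≤ τ) (hδ0 : 0 < δ)
    (hδ1 : δ ≤ 1) (hn : n ≤ 2 * m * τ + Real.log (1 / (δ / 2))) :
    splitBound n d k (δ / 2) ≤
      4 * 10 ^ 9 * τ + 4 * 10 ^ 9 * (d + Real.log (Real.exp 1 / δ)) / m := by
  have hm0 : (0 : ℝ) < m := by rw [hm]; positivity
  have hlog := log_one_div_nonneg hδ0 hδ1
  have hlog2 := Real.log_two_lt_d9
  have hmτ : 0 ≤ m * τ := mul_nonneg hm0.le hτ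
  rw [splitBound, log_exp_one_div_div hδ0 two_pos, log_exp_one_div hδ0,
    show (3 : ℝ) ^ k = m by rw [hm]; push_cast; rfl, div_le_iff₀ hm0, add_mul,
    div_mul_cancel₀ _ hm0.ne']
  rw [log_one_div_div hδ0 two_pos] at hn
  linarith [d.cast_nonneg (α := ℝ)]

variable [MeasurableSpace X]

theorem fractionError_ermFamily_add_six_le (D : Measure (Example X)) [IsProbabilityMeasure D]
    {A : Learner X} (hA : IsMeasurableLearner A) {k : ℕ} {S T : List (Example X)} {b : ℝ}
    (hb : ∀ p ∈ (range 27).offDiag,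
      6318 * jointError D (10 / 243) (blockFamily A k S T p.1) (blockFamily A k S T p.2) ≤ b) :
    fractionError D (10 / 243) (ermFamily A (k + 6) S T) ≤ b := by
  have hsum := fractionError_flatMap_range_le D (n := 27) (length_blockFamily A k S T)
    (hA.measurable_avgNe_blockFamily k S T) (10 / 243)
  have hle := sum_le_card_nsmul _ (fun p : ℕ × ℕ =>
    jointError D (10 / 243) (blockFamily A k S T p.1) (blockFamily A k S T p.2)) (b / 6318)
    fun p hp => by
      have := hb p hp
      linarith
  rw [← ermFamily_add_six] at hsum
  simp only [offDiag_card, card_range, nsmul_eq_mul] at hle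
  norm_num at hsum hle
  linarith

/-- The samples `z` on which the splitting algorithm, run on the subsequences of `z` with indices
`s` and `t`, where `|s| = 3 ^ k`, violates its error bound relative to `h`. -/
def splitErrorEvent (D : Measure (Example X)) (A : Learner X) (h : Hypothesis X) (d k : ℕ)
    (s t : List I) (δ : ℝ) : Set (I → Example X) :=
  {z | splitBound (errorCount h ((s ++ t).map z)) d k δ <
    fractionError D (10 / 243) (ermFamily A k (s.map z) (t.map z))}

/-- The samples `z` on which the families of the recursive calls `p.1` and `p.2` of the splitting
algorithm, run on the subsequences of `z` with indices `s` and `t`, where `|s| = 3 ^ (k + 6)`,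
violate the bound on their joint error. -/
def jointErrorEvent (D : Measure (Example X)) (A : Learner X) (h : Hypothesis X) (d k : ℕ)
    (s t : List I) (δ : ℝ) (p : ℕ × ℕ) : Set (I → Example X) :=
  {z | jointBound (fractionError D (10 / 243) (blockFamily A k (s.map z) (t.map z) p.1))
      (errorCount h ((s ++ t).map z)) d k δ <
    jointError D (10 / 243) (blockFamily A k (s.map z) (t.map z) p.1)
      (blockFamily A k (s.map z) (t.map z) p.2)}

theorem splitErrorEvent_of_lt_six (D : Measure (Example X)) [IsProbabilityMeasure D]
    (A : Learner X) (h : Hypothesis X) (d : ℕ) {k : ℕ} (hk : k < 6) (s t : List I)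
    (hδ0 : 0 < δ) (hδ1 : δ ≤ 1) : splitErrorEvent D A h d k s t δ = ∅ :=
  Set.eq_empty_of_forall_notMem fun _ hz =>
    (hz.trans_le measureReal_le_one).not_ge (one_le_splitBound hk hδ0 hδ1)

theorem splitErrorEvent_add_six_subset (D : Measure (Example X)) [IsProbabilityMeasure D]
    {A : Learner X} (hA : IsMeasurableLearner A) (h : Hypothesis X) (d k : ℕ) (s t : List I)
    (hδ0 : 0 < δ) (hδ1 : δ ≤ 1) :
    splitErrorEvent D A h d (k + 6) s t δ ⊆
      (⋃ j ∈ range 27,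
        splitErrorEvent D A h d k (activeBlock k s j) (reservedBlock k s j ++ t) (δ / 54)) ∪
      ⋃ p ∈ (range 27).offDiag, jointErrorEvent D A h d k s t (δ / 2808) p := by
  intro z hz
  by_contra hgood
  simp only [Set.mem_union, Set.mem_iUnion₂, not_or, not_exists, splitErrorEvent, jointErrorEvent,
    Set.mem_ofPred_eq, not_lt] at hgood
  obtain ⟨hsplit, hjoint⟩ := hgood
  refine hz.not_ge (fractionError_ermFamily_add_six_le D hA fun p hp => ?_)
  have hblock : fractionError D (10 / 243) (blockFamily A k (s.map z) (t.map z) p.1) ≤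
      splitBound (errorCount h ((s ++ t).map z)) d k (δ / 54) := by
    have hle := hsplit p.1 (mem_offDiag.1 hp).1
    rw [ermFamily_map, ← blockFamily_map] at hle
    exact hle.trans (splitBound_mono (errorCount_map_le_of_subperm h z
      (activeBlock_append_reservedBlock_append_sublist k s t p.1).subperm))
  calc _ ≤ 6318 * jointBound _ _ d k (δ / 2808) := by
        gcongr
        exact hjoint p hp
    _ ≤ _ := jointBound_le hδ0 hδ1 hblock

variable [Fintype I]

theorem measureReal_splitErrorEvent_le (D : Measure (Example X)) [IsProbabilityMeasure D]
    {H : Set (Hypothesis X)} (hd : vcDim H ≤ d) {A : Learner X} (hA : IsERM H A)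
    (hAm : IsMeasurableLearner A) {h : Hypothesis X} (hh : h ∈ H) (hhm : Measurable h) {k : ℕ}
    {s t : List I} (hst : (s ++ t).Nodup) (hs : s.length = 3 ^ k) (hδ0 : 0 < δ) (hδ1 : δ ≤ 1) :
    (Measure.pi fun _ : I => D).real (splitErrorEvent D A h d k s t δ) ≤ δ := by
  induction k using induction_six generalizing s t δ with
  | lt_six k hk =>
    rw [splitErrorEvent_of_lt_six D A h d hk s t hδ0 hδ1, measureReal_empty]
    exact hδ0.le
  | add_six k ih =>
    set μ := Measure.pi fun _ : I => D
    have hsplit (j) (hj : j ∈ range 27) : μ.real (splitErrorEvent D A h d k (activeBlock k s j)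
        (reservedBlock k s j ++ t) (δ / 54)) ≤ δ / 54 :=
      ih (hst.sublist (activeBlock_append_reservedBlock_append_sublist k s t j))
        (length_activeBlock hs (mem_range.1 hj)) (by positivity) (by linarith)
    have hjoint (p) (hp : p ∈ (range 27).offDiag) :
        μ.real (jointErrorEvent D A h d k s t (δ / 2808) p) ≤ 2 * (δ / 2808) := by
      obtain ⟨-, hp2, hne⟩ := mem_offDiag.1 hp
      exact measureReal_jointError_blockFamily_le D hd hA hAm hh hhm hst hs hne
        (mem_range.1 hp2) (10 / 243) (by norm_num) (by norm_num) (by positivity) (by linarith)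
    calc μ.real (splitErrorEvent D A h d (k + 6) s t δ)
      _ ≤ μ.real (⋃ j ∈ range 27, splitErrorEvent D A h d k (activeBlock k s j)
            (reservedBlock k s j ++ t) (δ / 54)) +
          μ.real (⋃ p ∈ (range 27).offDiag, jointErrorEvent D A h d k s t (δ / 2808) p) :=
        (measureReal_mono (splitErrorEvent_add_six_subset D hAm h d k s t hδ0 hδ1)).trans
          (measureReal_union_le _ _)
      _ ≤ #(range 27) • (δ / 54) + #(range 27).offDiag • (2 * (δ / 2808)) := by
        gcongr
        · exact (measureReal_biUnion_finset_le _ _).trans (sum_le_card_nsmul _ _ _ hsplit)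
        · exact (measureReal_biUnion_finset_le _ _).trans (sum_le_card_nsmul _ _ _ hjoint)
      _ = δ := by
        simp only [offDiag_card, card_range, nsmul_eq_mul]
        push_cast
        ring

theorem measureReal_splitBound_lt_le (D : Measure (Example X)) [IsProbabilityMeasure D]
    {H : Set (Hypothesis X)} (hd : vcDim H ≤ d) {A : Learner X} (hA : IsERM H A)
    (hAm : IsMeasurableLearner A) {h : Hypothesis X} (hh : h ∈ H) (hhm : Measurable h) {k m : ℕ}
    (hm : m = 3 ^ k) (hδ0 : 0 < δ) (hδ1 : δ ≤ 1) :
    (Measure.pi fun _ : Fin m => D).real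
      {S | splitBound (hits (errorSet h) S) d k δ <
        fractionError D (10 / 243) (ermFamily A k (List.ofFn S) [])} ≤ δ := by
  have hle := measureReal_splitErrorEvent_le D hd hA hAm hh hhm (s := List.finRange m) (t := [])
    (by simpa using List.nodup_finRange m) (by simpa using hm) hδ0 hδ1
  simpa only [splitErrorEvent, List.append_nil, List.map_nil, ← List.ofFn_eq_map,
    errorCount_ofFn] using hle

theorem one_sub_add_le_measureReal_compl_union {α : Type*} [MeasurableSpace α] {μ : Measure α}
    [IsProbabilityMeasure μ] (s t : Set α) :
    1 - (μ.real s + μ.real t) ≤ μ.real (s ∪ t)ᶜ := by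
  have hunion := measureReal_union_le (μ := μ) (s ∪ t) (s ∪ t)ᶜ
  rw [Set.union_compl_self, probReal_univ] at hunion
  linarith [measureReal_union_le (μ := μ) s t]

end SplittingError

end AgnosticERM

theorem mainTheorem5_general :
    ∃ c : ℝ, 1 ≤ c ∧
      ∀ (X : Type*) [MeasurableSpace X] (H : Set (Hypothesis X)) (d : ℕ) (_hd : vcDim H ≤ d)
        (A : Learner X) (_hA : IsERM H A) (_hAm : IsMeasurableLearner A)
        (D : Measure (Example X)) [IsProbabilityMeasure D]
        (h : Hypothesis X) (_hh : h ∈ H) (_hhm : Measurable h)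
        (δ : ℝ) (_hδ0 : 0 < δ) (_hδ1 : δ ≤ 1) (k m : ℕ) (_hm : m = 3 ^ k),
        1 - δ ≤ (Measure.pi (fun _ : Fin m => D)).real
          {S : Fin m → Example X |
            fractionError D (10 / 243) (ermFamily A k (List.ofFn S) []) ≤
              c * trueError D h + c * ((d : ℝ) + Real.log (Real.exp 1 / δ)) / (m : ℝ)} := by
  refine ⟨4 * 10 ^ 9, by norm_num, fun X _ H d hd A hA hAm D _ h hh hhm δ hδ0 hδ1 k m hm => ?_⟩
  set manyErrors := {S : Fin m → Example X |
    2 * m * trueError D h + Real.log (1 / (δ / 2)) < hits (errorSet h) S}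
  set splitError := {S : Fin m → Example X | splitBound (hits (errorSet h) S) d k (δ / 2) <
    fractionError D (10 / 243) (ermFamily A k (List.ofFn S) [])}
  have hmeas : MeasurableSet (errorSet h) :=
    measurableSet_errorSet measurable_id (hhm.comp measurable_fst)
  have hmany : (Measure.pi fun _ => D).real manyErrors ≤ δ / 2 := by
    have hle := measureReal_lt_hits_le (κ := Fin m) D hmeas (half_pos hδ0)
    rwa [Fintype.card_fin] at hle
  have hsplit : (Measure.pi fun _ => D).real splitError ≤ δ / 2 :=
    measureReal_splitBound_lt_le D hd hA hAm hh hhm hm (half_pos hδ0) (by linarith)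
  calc 1 - δ ≤ 1 - ((Measure.pi fun _ => D).real manyErrors +
          (Measure.pi fun _ => D).real splitError) := by linarith
    _ ≤ (Measure.pi fun _ => D).real (manyErrors ∪ splitError)ᶜ :=
        one_sub_add_le_measureReal_compl_union _ _
    _ ≤ _ := measureReal_mono fun S hS => by
        obtain ⟨hSmany, hSsplit⟩ := not_or.1 hS
        exact (le_of_not_gt hSsplit).trans
          (splitBound_half_le hm measureReal_nonneg hδ0 hδ1 (le_of_not_gt hSmany))

theorem mainTheorem5 :
    ∃ c : ℝ, 1 ≤ c ∧
      ∀ (X : Type*) [MeasurableSpace X]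
        (H : Set (Hypothesis X)) (_hH : ∀ h ∈ H, Measurable h)
        (d : ℕ) (_hd : vcDim H = (d : ℕ∞))
        (A : Learner X) (_hA : IsERM H A) (_hAm : IsMeasurableLearner A)
        (D : Measure (Example X)) [IsProbabilityMeasure D]
        (hstar : Hypothesis X) (_hstar_mem : hstar ∈ H)
        (_hstar_min : ∀ h ∈ H, trueError D hstar ≤ trueError D h)
        (δ : ℝ) (_hδ0 : 0 < δ) (_hδ1 : δ < 1)
        (k m : ℕ) (_hk : 6 ≤ k) (_hm : m = 3 ^ k),
        1 - δ ≤ (Measure.pi (fun _ : Fin m => D)).real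
          {S : Fin m → Example X |
            fractionError D (10 / 243) (ermFamily A k (List.ofFn S) []) ≤
              c * trueError D hstar
                + c * ((d : ℝ) + Real.log (Real.exp 1 / δ)) / (m : ℝ)} := by
  obtain ⟨c, hc, hbound⟩ := mainTheorem5_general
  exact ⟨c, hc, fun X _ H hH d hd A hA hAm D _ h hh _ δ hδ0 hδ1 k m _ hm =>
    hbound X H d hd.le A hA hAm D h hh (hH h hh) δ hδ0 hδ1.le k m hm⟩
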